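/- For $\mathbf a,\mathbf t\in\mathbb R^3$ let $\rho(\mathbf a,\mathrm{diag}\,\mathbf t)=\frac14\big(I\otimes I+\mathbf a\cdot\boldsymbol\sigma\otimes I+\sum_{i=1}^3 t_i\,\sigma_i\otimes\sigma_i\big)$, an operator on Alice's and Bob's qubits. A two-qubit state $\rho$ is called non-steerable (by projective measurements of Alice) if there are a probability space $(L,\mu)$ and a measurable family of qubit states $(\sigma_\lambda)_{\lambda\in L}$ such that for every projective measurement $\{\Pi_k\}_k$ on Alice's qubit there are measurable response functions $p_k\ge 0$ on $L$ with $\sum_k p_k=1$ and $\mathrm{Tr}_A[(\Pi_k\otimes I)\rho]=\int p_k(\lambda)\,\sigma_\lambda\,d\mu(\lambda)$ for all $k$. Let $0\le a<1$ and write $(t_1',t_2',t_3')=(r\sin\alpha\cos\beta,\ r\sin\alpha\sin\beta,\ r\cos\alpha)$ with $r\ge 0$, $\alpha\in[0,\pi]$ and $\beta\in[0,2\pi]$, $\cos\beta=\sin\beta$, so that $t_1'=t_2'$. Put $c=\frac{2\cot^2\alpha}{1-a}-1$ and $$ r(\alpha)=\frac{\sqrt{2(1-a)}}{\sin\alpha}\cdot\begin{cases}\Big[\sqrt{1+c}+\frac1{\sqrt{-c}}\arcsin\sqrt{-c}\Big]^{-1},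 & c<0,\\[4pt] \Big[\sqrt{1+c}+\frac{1}{2\sqrt c}\ln\frac{\sqrt{1+c}+\sqrt c}{\sqrt{1+c}-\sqrt c}\Big]^{-1}, & c>0,\end{cases}$$ extended by continuity, i.e. with the bracket $[\,\cdot\,]$ equal to $2$ at $c=0$, and $r(0)=r(\pi)=1-a$. (1) The surface $r=r(\alpha)$ consists of the images of the solutions of the T-state border equation under the extremal maps with $u=v$: one has $r=r(\alpha)$ if and only if there are $u\in[0,\pi)$ and $T=\mathrm{diag}(t_1,t_2,t_3)$ with $\frac1{2\pi}\iint\sqrt{\hat x^{\top}T^2\hat x}\;d^2\hat x=1$ (integral over the unit sphere) such that $(\Phi_{u,u}\otimes \mathrm{id})\,\rho(\mathbf 0,T)=\rho(a\hat e_z,\mathrm{diag}[t_1',t_2',t_3'])$. Here $\Phi_{u,v}$ is the linear map with $\Phi_{u,v}(I)=I+\sin u\sin v\,\sigma_3$, $\Phi_{u,v}(\sigma_1)=\cos u\,\sigma_1$, $\Phi_{u,v}(\sigma_2)=\cos v\,\sigma_2$, $\Phi_{u,v}(\sigma_3)=\cos u\cos v\,\sigma_3$. (2) If $r\le r(\alpha)$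 and $\rho(a\hat e_z,\mathrm{diag}[t_1',t_1',t_3'])$ is a state, then it is non-steerable. (3) For $a=1/10$ the states in (2) include, in the octant $t_i'\le 0$, an entangled state that violates the criterion $\max_{|\hat x|=1}\big[(\mathbf a\cdot\hat x)^2+2\|T'\hat x\|\big]\le 1$ of Bowles et al. -/

import Mathlib

open scoped Kronecker ComplexOrder

noncomputable section

namespace Steering

/-- Operators on one qubit. -/
abbrev Op := Matrix (Fin 2) (Fin 2) ℂ

/-- Operators on two qubits; the first index belongs to Alice, the second to Bob. -/
abbrev Op2 := Matrix (Fin 2 × Fin 2) (Fin 2 × Fin 2) ℂ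

/-- The identity `σ₀` followed by the Pauli matrices `σ₁, σ₂, σ₃`. -/
def pauli : Fin 4 → Op :=
  ![1, !![0, 1; 1, 0], !![0, -Complex.I; Complex.I, 0], !![1, 0; 0, -1]]

/-- Density operators: positive semidefinite with trace one. -/
def IsState {n : Type} [Fintype n] (ρ : Matrix n n ℂ) : Prop :=
  ρ.PosSemidef ∧ ρ.trace = 1

/-- The operator `¼ (I ⊗ I + a·σ ⊗ I + ∑ᵢ tᵢ σᵢ ⊗ σᵢ)` denoted by `(a, diag t)`. -/
def canonicalState (a t : Fin 3 → ℝ) : Op2 :=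
  (1 / 4 : ℂ) • ((1 : Op) ⊗ₖ (1 : Op)
    + ∑ i, (a i : ℂ) • (pauli i.succ ⊗ₖ (1 : Op))
    + ∑ i, (t i : ℂ) • (pauli i.succ ⊗ₖ pauli i.succ))

/-- Partial trace over Alice's qubit. -/
def traceA (X : Op2) : Op := fun j j' => ∑ i, X (i, j) (i, j')

/-- Projective measurements on a qubit with outcomes in `Fin n`. -/
def IsProjectiveMeasurement {n : ℕ} (P : Fin n → Op) : Prop :=
  (∀ k, (P k).IsHermitian ∧ P k * P k = P k) ∧ ∑ k, P k = 1

/-- Alice cannot steer Bob by projective measurements: a single ensemble of local hidden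
states of Bob reproduces, with suitable response functions, the unnormalised conditional
states `Tr_A[(P k ⊗ I) ρ]` of every projective measurement of Alice. -/
def NonSteerable (ρ : Op2) : Prop :=
  ∃ (L : Type) (_ : MeasurableSpace L) (μ : MeasureTheory.Measure L) (σ : L → Op),
    MeasureTheory.IsProbabilityMeasure μ ∧
    (∀ i j, Measurable fun l => σ l i j) ∧
    (∀ l, IsState (σ l)) ∧
    ∀ (n : ℕ) (P : Fin n → Op), IsProjectiveMeasurement P →
      ∃ p : Fin n → L → ℝ,
        (∀ k, Measurable (p k)) ∧ (∀ k l, 0 ≤ p k l) ∧ (∀ l, ∑ k, p k l = 1) ∧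
        ∀ k i j, traceA ((P k ⊗ₖ (1 : Op)) * ρ) i j = ∫ l, (p k l : ℂ) * σ l i j ∂μ

/-- Separable operators: convex combinations of product states. -/
def IsSeparable (ρ : Op2) : Prop :=
  ρ ∈ convexHull ℝ {τ : Op2 | ∃ ρA ρB : Op, IsState ρA ∧ IsState ρB ∧ τ = ρA ⊗ₖ ρB}

/-- The criterion of Bowles et al. for `(a, diag t)`:
`max_x [(a·x)² + 2‖T x‖] ≤ 1` over unit vectors `x`. -/
def BowlesCriterion (a t : Fin 3 → ℝ) : Prop :=
  ∀ x : Fin 3 → ℝ, ∑ i, x i ^ 2 = 1 →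
    (∑ i, a i * x i) ^ 2 + 2 * √(∑ i, (t i * x i) ^ 2) ≤ 1

/-- The vector with spherical coordinates `r, α, β` (`α` is the polar angle). -/
def sph (r α β : ℝ) : Fin 3 → ℝ :=
  ![r * Real.sin α * Real.cos β, r * Real.sin α * Real.sin β, r * Real.cos α]

/-- The border equation of T-states, `(1/2π) ∬ √(xᵀ T² x) d²x = 1` for `T = diag t`, with
the surface integral over the unit sphere written in spherical coordinates. -/
def IsBorderT (t : Fin 3 → ℝ) : Prop :=
  (1 / (2 * Real.pi)) *
    (∫ φ in (0 : ℝ)..(2 * Real.pi), ∫ θ in (0 : ℝ)..Real.pi,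
      √(∑ i, t i ^ 2 * sph 1 θ φ i ^ 2) * Real.sin θ) = 1

/-- The matrix, in the basis `σ₀, …, σ₃`, of the extremal qubit channel with parameters
`u, v`. -/
def extremalMatrix (u v : ℝ) : Matrix (Fin 4) (Fin 4) ℝ :=
  !![1, 0, 0, 0;
     0, Real.cos u, 0, 0;
     0, 0, Real.cos v, 0;
     Real.sin u * Real.sin v, 0, 0, Real.cos u * Real.cos v]

/-- The qubit map with `Φ(σ_ν) = ∑_μ M_{μν} σ_μ`; the coefficient of `σ_ν` in `X` is
`Tr(σ_ν X) / 2`. -/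
def pauliMap (M : Matrix (Fin 4) (Fin 4) ℝ) (X : Op) : Op :=
  ∑ μ, ∑ ν, ((M μ ν : ℂ) * ((pauli ν * X).trace / 2)) • pauli μ

/-- `(Φ ⊗ id) ρ`: the map `Φ` applied to Alice's qubit. -/
def applyAlice (Φ : Op → Op) (ρ : Op2) : Op2 :=
  fun x y => Φ (fun i i' => ρ (i, x.2) (i', y.2)) x.1 y.1

/-- The bracket of the closed formula, with its limit `2` at `c = 0`. -/
def bracket (c : ℝ) : ℝ :=
  if c < 0 then √(1 + c) + 1 / √(-c) * Real.arcsin √(-c)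
  else if c = 0 then 2
  else √(1 + c) + 1 / (2 * √c) * Real.log ((√(1 + c) + √c) / (√(1 + c) - √c))

/-- The radius of the surface in the direction of polar angle `α`, with its limit `1 - a`
on the polar axis. -/
def surfaceRadius (a α : ℝ) : ℝ :=
  if Real.sin α = 0 then 1 - a
  else √(2 * (1 - a)) / Real.sin α *
    (bracket (2 * Real.cot α ^ 2 / (1 - a) - 1))⁻¹

end Steering

end

/-! The T-state of `T = diag t` has a local hidden state model as soon as `borderIntegral t ≤ 1`.
The hidden variable is a vector `y` of the unit ball with density proportional to `‖T y‖`, Bob's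
hidden state has Bloch vector `T y / ‖T y‖`, and Alice answers to the direction `v` with the sign
of `y · v`. The factor `‖T y‖` cancels, and what remains is `T` applied to the first moment of a
half ball, which is parallel to `v`. By homogeneity the total mass of the density is, up to a
constant, the integral of the border equation; if it is too small, the missing mass is added with
hidden states that are completely mixed.

Extremal maps have Kraus operators. Their adjoints turn a projection of Alice into an effect,
which is a mixture of a projection and its complement, so that a hidden state model of `ρ` is also
one of `(Φ ⊗ id) ρ`. For `sin² u = a` the map `Φ_{u,u}` is invertible on diagonal correlation
matrices, and an elementary integral shows that the border integral of the preimage of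
`(a, diag t')` is `r / r(α)`.

The example is `cos α = -3/7` and `r = 4/5`, where `c = -1/2`; the expectation of the swap
operator is negative there, although it is nonnegative on separable operators. -/

namespace Steering

open MeasureTheory

/-! ### Non-steerability and channels on the side of Alice -/

theorem trace_eq_rank_of_isIdempotentElem {n K : Type*} [Fintype n] [Field K]
    {Q : Matrix n n K} (hQ : IsIdempotentElem Q) : Q.trace = Q.rank := by
  classical
  rw [← Matrix.trace_toLin'_eq]
  exact (LinearMap.IsIdempotentElem.isProj_range _ (hQ.map Matrix.toLinAlgEquiv')).trace

theorem rank_ne_zero_of_ne_zero {n K : Type*} [Fintype n] [Field K] {Q : Matrix n n K}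
    (hQ : Q ≠ 0) : Q.rank ≠ 0 := by
  classical
  contrapose! hQ
  rw [Matrix.rank, Submodule.finrank_eq_zero, LinearMap.range_eq_bot] at hQ
  exact (Matrix.toLin' (R := K)).map_eq_zero_iff.1 hQ

theorem IsProjectiveMeasurement.exists_eq_single_add_single {n : ℕ} {P : Fin n → Op}
    (hP : IsProjectiveMeasurement P) :
    ∃ k l Q, IsStarProjection Q ∧ P = Pi.single k Q + Pi.single l (1 - Q) := by
  have hrank : ∑ k, (P k).rank = 2 := by
    have htrace : ∑ k, (P k).trace = 2 := by simp [← Matrix.trace_sum, hP.2]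
    simp_rw [trace_eq_rank_of_isIdempotentElem (hP.1 _).2] at htrace
    exact_mod_cast htrace
  obtain ⟨k, -, hk⟩ := Finset.exists_ne_zero_of_sum_ne_zero (hrank ▸ two_ne_zero)
  obtain ⟨l, hl⟩ : ∃ l, ∀ j, j ≠ k → j ≠ l → P j = 0 := by
    -- Three nonzero projections would have ranks adding up to at least three.
    by_contra! h
    obtain ⟨l, hlk, -, hl⟩ := h k
    obtain ⟨j, hjk, hjl, hj⟩ := h l
    have hle := Finset.sum_le_univ_sum_of_nonneg (s := {k, l, j}) fun i => (P i).rank.zero_le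
    rw [hrank, Finset.sum_insert (by grind), Finset.sum_pair hjl.symm] at hle
    have := rank_ne_zero_of_ne_zero hl
    have := rank_ne_zero_of_ne_zero hj
    lia
  have hsum : 1 - P k = ∑ j ∈ Finset.univ.erase k, P j := by
    rw [sub_eq_iff_eq_add', ← hP.2, Finset.add_sum_erase _ _ (Finset.mem_univ k)]
  refine ⟨k, l, P k, ⟨(hP.1 k).2, (hP.1 k).1⟩, funext fun j => ?_⟩
  obtain rfl | hlk := eq_or_ne l k
  · rw [Finset.sum_eq_zero (by grind)] at hsum
    by_cases hj : j = l <;> simp_all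
  · rw [Finset.sum_eq_single l (by grind) (by grind)] at hsum
    by_cases hjk : j = k <;> by_cases hjl : j = l <;> simp_all

/-- Bob's unnormalised state `Tr_A[(E ⊗ I) ρ]` conditional on the effect `E` of Alice, as a
linear function of `E`. -/
def conditionalState (ρ : Op2) : Op →ₗ[ℂ] Op where
  toFun E := traceA ((E ⊗ₖ (1 : Op)) * ρ)
  map_add' E F := by
    ext
    simp only [traceA, Matrix.add_kronecker, add_mul, Matrix.add_apply, Finset.sum_add_distrib]
  map_smul' c E := by
    ext
    simp only [traceA, Matrix.smul_kronecker, smul_mul_assoc, Matrix.smul_apply,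
      RingHom.id_apply, Finset.smul_sum]

theorem conditionalState_apply (ρ : Op2) (E : Op) (j j' : Fin 2) :
    conditionalState ρ E j j' = (E * Matrix.of fun i i' => ρ (i, j) (i', j')).trace := by
  simp [conditionalState, traceA, Matrix.trace, Matrix.mul_apply, Fintype.sum_prod_type,
    Matrix.one_apply]

/-- The completely positive map `X ↦ ∑ᵢ Kᵢ X Kᵢᴴ` with Kraus operators `Kᵢ`. -/
def krausMap {ι n : Type*} [Fintype ι] [Fintype n] (K : ι → Matrix n n ℂ) (X : Matrix n n ℂ) :
    Matrix n n ℂ :=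
  ∑ i, K i * X * (K i).conjTranspose

theorem trace_mul_krausMap {ι n : Type*} [Fintype ι] [Fintype n] (K : ι → Matrix n n ℂ)
    (E X : Matrix n n ℂ) :
    (E * krausMap K X).trace = (krausMap (fun i => (K i).conjTranspose) E * X).trace := by
  simp only [krausMap, Finset.mul_sum, Finset.sum_mul, Matrix.trace_sum,
    Matrix.conjTranspose_conjTranspose]
  refine Finset.sum_congr rfl fun i _ => ?_
  rw [← mul_assoc, Matrix.trace_mul_comm]
  simp only [mul_assoc]

theorem posSemidef_krausMap {ι n : Type*} [Fintype ι] [Fintype n] (K : ι → Matrix n n ℂ)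
    {X : Matrix n n ℂ} (hX : X.PosSemidef) : (krausMap K X).PosSemidef := by
  have h (i) := hX.mul_mul_conjTranspose_same (K i)
  exact Matrix.posSemidef_sum _ fun i _ => h i

theorem conditionalState_applyAlice_krausMap {ι : Type*} [Fintype ι] (K : ι → Op) (ρ : Op2)
    (E : Op) :
    conditionalState (applyAlice (krausMap K) ρ) E
      = conditionalState ρ (krausMap (fun i => (K i).conjTranspose) E) := by
  ext j j'
  have hblock : (Matrix.of fun i i' => applyAlice (krausMap K) ρ (i, j) (i', j'))
      = krausMap K (Matrix.of fun i i' => ρ (i, j) (i', j')) := rfl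
  rw [conditionalState_apply, conditionalState_apply, hblock, trace_mul_krausMap]

theorem IsState.norm_apply_le_one {n : Type} [Fintype n] {σ : Matrix n n ℂ} (hσ : IsState σ)
    (i j : n) : ‖σ i j‖ ≤ 1 := by
  have hdiag (i : n) : ∃ x : ℝ, 0 ≤ x ∧ x ≤ 1 ∧ σ i i = x := by
    have hle : σ i i ≤ 1 := hσ.2 ▸ Finset.single_le_sum (f := fun k => σ k k)
      (fun k _ => hσ.1.diag_nonneg) (Finset.mem_univ i)
    lift σ i i to ℝ using (Complex.nonneg_iff.1 hσ.1.diag_nonneg).2.symm with x hx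
    have h0 : 0 ≤ σ i i := hσ.1.diag_nonneg
    rw [← hx] at h0
    exact ⟨x, by exact_mod_cast h0, by exact_mod_cast hle, rfl⟩
  obtain ⟨x, _, hx1, hx⟩ := hdiag i
  obtain ⟨y, hy0, hy1, hy⟩ := hdiag j
  have hminor := (hσ.1.submatrix ![i, j]).det_nonneg
  simp only [Matrix.det_fin_two, Matrix.submatrix_apply, Matrix.cons_val_zero,
    Matrix.cons_val_one, hx, hy, ← hσ.1.1.apply j i, Complex.star_def, Complex.mul_conj] at hminor
  have hle : Complex.normSq (σ i j) ≤ x * y := by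
    rw [← sub_nonneg]
    exact_mod_cast hminor
  rw [← sq_le_one_iff₀ (norm_nonneg _), ← Complex.normSq_eq_norm_sq]
  exact hle.trans (mul_le_one₀ hx1 hy0 hy1)

theorem eigenvalues_le_one {n : Type*} [Fintype n] [DecidableEq n] {A : Matrix n n ℂ}
    (hA : A.IsHermitian) (h : (1 - A).PosSemidef) (i : n) : hA.eigenvalues i ≤ 1 := by
  have hnonneg := h.re_dotProduct_nonneg (hA.eigenvectorBasis i)
  have hnorm := inner_self_eq_norm_sq (𝕜 := ℂ) (hA.eigenvectorBasis i)
  rw [Matrix.sub_mulVec, dotProduct_sub, map_sub, ← hA.eigenvalues_eq, Matrix.one_mulVec,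
    dotProduct_comm, ← EuclideanSpace.inner_eq_star_dotProduct, hnorm,
    hA.eigenvectorBasis.norm_eq_one] at hnonneg
  linarith

theorem exists_isStarProjection_eq_smul_add_smul {E : Op} (hE : E.PosSemidef)
    (hE' : (1 - E).PosSemidef) :
    ∃ Q : Op, IsStarProjection Q ∧ ∃ w ∈ Set.Icc (0 : ℝ) 1, ∃ w' ∈ Set.Icc (0 : ℝ) 1,
      E = (w : ℂ) • Q + (w' : ℂ) • (1 - Q) := by
  let φ := Unitary.conjStarAlgAut ℂ Op hE.1.eigenvectorUnitary
  have hweight (i) : hE.1.eigenvalues i ∈ Set.Icc (0 : ℝ) 1 :=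
    ⟨hE.eigenvalues_nonneg i, eigenvalues_le_one hE.1 hE' i⟩
  refine ⟨φ (Matrix.diagonal ![1, 0]), ?_, _, hweight 0, _, hweight 1, ?_⟩
  · refine IsStarProjection.map ⟨?_, ?_⟩ φ
    · simp [IsIdempotentElem, Matrix.diagonal_mul_diagonal]
    · exact Matrix.isHermitian_diagonal_of_self_adjoint _ (by simp [IsSelfAdjoint, funext_iff])
  · conv_lhs => rw [hE.1.spectral_theorem]
    rw [← map_one φ, ← map_sub, ← map_smul, ← map_smul, ← map_add]
    congr 1
    ext i j
    fin_cases i <;> fin_cases j <;> simp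

/-- An ensemble of hidden states of Bob: qubit states `σ l` depending measurably on a parameter
`l` with probability law `μ`. -/
structure IsEnsemble {L : Type*} [MeasurableSpace L] (μ : Measure L) (σ : L → Op) : Prop where
  isProbabilityMeasure : IsProbabilityMeasure μ
  measurable : ∀ i j, Measurable fun l => σ l i j
  isState : ∀ l, IsState (σ l)

/-- `p` is a response function that reproduces, from the ensemble of hidden states `(μ, σ)`,
Bob's conditional state for the effect `E` of Alice on `ρ`. -/
structure IsResponse {L : Type*} [MeasurableSpace L] (μ : Measure L) (σ : L → Op) (ρ : Op2)
    (E : Op) (p : L → ℝ) : Prop where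
  measurable : Measurable p
  mem_Icc : ∀ l, p l ∈ Set.Icc 0 1
  conditionalState_eq : ∀ i j, conditionalState ρ E i j = ∫ l, (p l : ℂ) * σ l i j ∂μ

section Response

variable {L : Type*} [MeasurableSpace L] {μ : Measure L} {σ : L → Op} {ρ : Op2} {E : Op}
  {p : L → ℝ}

theorem IsEnsemble.integrable_mul (h : IsEnsemble μ σ) (hp : Measurable p)
    (hp' : ∀ l, p l ∈ Set.Icc 0 1) (i j : Fin 2) :
    Integrable (fun l => (p l : ℂ) * σ l i j) μ := by
  have := h.isProbabilityMeasure
  have := h.measurable i j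
  refine Integrable.of_bound (by fun_prop) 1 (ae_of_all _ fun l => ?_)
  rw [norm_mul, Complex.norm_real, Real.norm_of_nonneg (hp' l).1]
  exact mul_le_one₀ (hp' l).2 (norm_nonneg _) ((h.isState l).norm_apply_le_one i j)

theorem IsResponse.smul_add_smul (hσ : IsEnsemble μ σ) (hone : IsResponse μ σ ρ 1 1)
    (hp : IsResponse μ σ ρ E p) {w w' : ℝ} (hw : w ∈ Set.Icc 0 1) (hw' : w' ∈ Set.Icc 0 1) :
    IsResponse μ σ ρ ((w : ℂ) • E + (w' : ℂ) • (1 - E)) fun l => w * p l + w' * (1 - p l) where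
  measurable := (hp.measurable.const_mul w).add ((measurable_const.sub hp.measurable).const_mul w')
  mem_Icc l := by
    have := convex_iff_add_mem.1 (convex_Icc (0 : ℝ) 1) hw hw' (hp.mem_Icc l).1
      (sub_nonneg.2 (hp.mem_Icc l).2) (add_sub_cancel _ _)
    simpa only [smul_eq_mul, mul_comm] using this
  conditionalState_eq i j := by
    have hint := hσ.integrable_mul hp.measurable hp.mem_Icc i j
    have hint1 := hσ.integrable_mul hone.measurable hone.mem_Icc i j
    simp only [map_add, map_smul, map_sub, Matrix.add_apply, Matrix.smul_apply, Matrix.sub_apply,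
      hp.conditionalState_eq, hone.conditionalState_eq, smul_eq_mul]
    rw [← integral_sub hint1 hint, ← integral_const_mul, ← integral_const_mul, ← integral_add]
    · refine integral_congr_ae (ae_of_all _ fun l => ?_)
      simp only [Pi.one_apply]
      push_cast
      ring
    all_goals fun_prop

end Response

theorem posSemidef_of_isStarProjection {n : Type*} [Fintype n] {Q : Matrix n n ℂ}
    (hQ : IsStarProjection Q) : Q.PosSemidef := by
  have h := Matrix.posSemidef_conjTranspose_mul_self Q
  rwa [show Q.conjTranspose = Q from hQ.isSelfAdjoint, hQ.isIdempotentElem] at h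

theorem isProjectiveMeasurement_pair {Q : Op} (hQ : IsStarProjection Q) :
    IsProjectiveMeasurement ![Q, 1 - Q] := by
  refine ⟨fun k => ?_, by simp⟩
  fin_cases k
  · exact ⟨hQ.isSelfAdjoint, hQ.isIdempotentElem⟩
  · exact ⟨hQ.one_sub.isSelfAdjoint, hQ.one_sub.isIdempotentElem⟩

theorem nonSteerable_iff {ρ : Op2} :
    NonSteerable ρ ↔ ∃ (L : Type) (_ : MeasurableSpace L) (μ : Measure L) (σ : L → Op),
      IsEnsemble μ σ ∧ IsResponse μ σ ρ 1 1 ∧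
        ∀ Q, IsStarProjection Q → ∃ p, IsResponse μ σ ρ Q p := by
  refine exists₄_congr fun L _ μ σ => ⟨fun ⟨hμ, hσm, hσ, h⟩ => ⟨⟨hμ, hσm, hσ⟩, ?_, fun Q hQ => ?_⟩,
    fun ⟨hσ, hone, h⟩ => ⟨hσ.1, hσ.2, hσ.3, fun n P hP => ?_⟩⟩
  · obtain ⟨p, hpm, -, hp1, hp⟩ := h 1 1 ⟨fun _ => ⟨Matrix.isHermitian_one, one_mul _⟩, by simp⟩
    obtain rfl : p = 1 := funext₂ fun k l => by simpa [Subsingleton.elim k 0] using hp1 l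
    exact ⟨hpm 0, fun l => ⟨zero_le_one, le_rfl⟩, hp 0⟩
  · obtain ⟨p, hpm, hp0, hp1, hp⟩ := h 2 _ (isProjectiveMeasurement_pair hQ)
    have hle (l) : p 0 l ≤ 1 := by
      linarith [hp0 1 l, (Fin.sum_univ_two (p · l)).symm.trans (hp1 l)]
    exact ⟨p 0, hpm 0, fun l => ⟨hp0 0 l, hle l⟩, hp 0⟩
  · obtain ⟨k, l, Q, hQ, rfl⟩ := hP.exists_eq_single_add_single
    obtain ⟨p, hp⟩ := h Q hQ
    have hp' : IsResponse μ σ ρ (1 - Q) (1 - p) := by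
      simpa [Pi.sub_def] using
        hone.smul_add_smul hσ hp (w := 0) (w' := 1) (by simp) (by simp)
    have hzero : IsResponse μ σ ρ 0 0 := ⟨measurable_const, fun _ => by simp, by simp⟩
    have hresp (j) : IsResponse μ σ ρ ((Pi.single k Q + Pi.single l (1 - Q) : Fin n → Op) j)
        ((Pi.single k p + Pi.single l (1 - p) : Fin n → L → ℝ) j) := by
      simp only [Pi.add_apply, Pi.single_apply]
      split_ifs <;> simpa
    exact ⟨_, fun j => (hresp j).measurable, fun j x => ((hresp j).mem_Icc x).1,
      fun x => by simp [← Finset.sum_apply, Finset.sum_add_distrib],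
      fun j => (hresp j).conditionalState_eq⟩

theorem NonSteerable.applyAlice_krausMap {ι : Type*} [Fintype ι] {K : ι → Op}
    (hK : ∑ i, (K i).conjTranspose * K i = 1) {ρ : Op2} (h : NonSteerable ρ) :
    NonSteerable (applyAlice (krausMap K) ρ) := by
  let Kdual := krausMap fun i => (K i).conjTranspose
  have hdual_one : Kdual 1 = 1 := by simpa [krausMap, Kdual] using hK
  have hdual_sub (E F) : Kdual (E - F) = Kdual E - Kdual F := by
    simp [Kdual, krausMap, mul_sub, sub_mul]
  obtain ⟨L, _, μ, σ, hσ, hone, hresp⟩ := nonSteerable_iff.1 h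
  have hpull {E p} (hp : IsResponse μ σ ρ (Kdual E) p) :
      IsResponse μ σ (applyAlice (krausMap K) ρ) E p :=
    ⟨hp.measurable, hp.mem_Icc, fun i j => by
      rw [conditionalState_applyAlice_krausMap, hp.conditionalState_eq]⟩
  refine nonSteerable_iff.2 ⟨L, _, μ, σ, hσ, hpull (by rwa [hdual_one]), fun Q hQ => ?_⟩
  obtain ⟨Q', hQ', w, hw, w', hw', hE⟩ := exists_isStarProjection_eq_smul_add_smul
    (E := Kdual Q) (posSemidef_krausMap _ (posSemidef_of_isStarProjection hQ))
    (by
      rw [← hdual_one, ← hdual_sub]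
      exact posSemidef_krausMap _ (posSemidef_of_isStarProjection hQ.one_sub))
  obtain ⟨p, hp⟩ := hresp Q' hQ'
  exact ⟨_, hpull (hE ▸ hone.smul_add_smul hσ hp hw hw')⟩

/-! ### Canonical states, extremal maps and entanglement -/

theorem canonicalState_apply (a t : Fin 3 → ℝ) (x y : Fin 2 × Fin 2) :
    canonicalState a t x y = (1 / 4 : ℂ) * ((1 : Op) x.1 y.1 * (1 : Op) x.2 y.2
      + ∑ i, (a i : ℂ) * (pauli i.succ x.1 y.1 * (1 : Op) x.2 y.2)
      + ∑ i, (t i : ℂ) * (pauli i.succ x.1 y.1 * pauli i.succ x.2 y.2)) := by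
  simp only [canonicalState, Matrix.smul_apply, Matrix.add_apply, Matrix.sum_apply,
    Matrix.kroneckerMap_apply, smul_eq_mul]

theorem posSemidef_fin_two {x z : ℝ} {y : ℂ} (htrace : 0 ≤ x + z)
    (hdet : Complex.normSq y ≤ x * z) : (!![(x : ℂ), y; star y, (z : ℂ)]).PosSemidef := by
  have hA : (!![(x : ℂ), y; star y, (z : ℂ)]).IsHermitian := by
    ext i j
    fin_cases i <;> fin_cases j <;> simp
  have hsum : x + z = hA.eigenvalues 0 + hA.eigenvalues 1 := by
    simpa [Fin.sum_univ_two] using congrArg Complex.re hA.trace_eq_sum_eigenvalues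
  have hprod : x * z - Complex.normSq y = hA.eigenvalues 0 * hA.eigenvalues 1 := by
    simpa [Matrix.det_fin_two, Fin.prod_univ_two, Complex.mul_conj] using
      congrArg Complex.re hA.det_eq_prod_eigenvalues
  rw [hA.posSemidef_iff_eigenvalues_nonneg, Pi.le_def, Fin.forall_fin_two, Pi.zero_apply,
    Pi.zero_apply]
  constructor <;> nlinarith

theorem trace_pauli_mul_pauli (μ ν : Fin 4) :
    (pauli μ * pauli ν).trace = if μ = ν then 2 else 0 := by
  fin_cases μ <;> fin_cases ν <;>
    simp [pauli, Matrix.trace_fin_two, one_add_one_eq_two]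

theorem trace_pauli (ν : Fin 4) : (pauli ν).trace = if ν = 0 then 2 else 0 := by
  simpa [pauli] using trace_pauli_mul_pauli ν 0

theorem conditionalState_canonicalState (a t : Fin 3 → ℝ) (E : Op) :
    conditionalState (canonicalState a t) E = (1 / 4 : ℂ) •
      ((E.trace + ∑ i, a i * (E * pauli i.succ).trace) • (1 : Op)
        + ∑ i, (t i * (E * pauli i.succ).trace) • pauli i.succ) := by
  ext j j'
  have hblock : (Matrix.of fun i i' => canonicalState a t (i, j) (i', j'))
      = (1 / 4 : ℂ) • ((1 : Op) j j' • (1 : Op)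
        + ∑ i, (a i * (1 : Op) j j') • pauli i.succ
        + ∑ i, (t i * pauli i.succ j j') • pauli i.succ) := by
    ext i i'
    simp only [Matrix.of_apply, canonicalState_apply, Matrix.smul_apply, Matrix.add_apply,
      Matrix.sum_apply, smul_eq_mul, mul_comm ((1 : Op) i i'), mul_comm (pauli _ i i'), mul_assoc]
  rw [conditionalState_apply, hblock]
  simp only [Matrix.mul_smul, mul_add, Finset.mul_sum, mul_one, Matrix.trace_smul,
    Matrix.trace_add, Matrix.trace_sum, Matrix.smul_apply, Matrix.add_apply, Matrix.sum_apply,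
    smul_eq_mul, Finset.sum_mul, add_mul, mul_right_comm (_ : ℂ) _ (E * _).trace,
    mul_comm ((1 : Op) j j')]

theorem canonicalState_inj {a t a' t' : Fin 3 → ℝ} :
    canonicalState a t = canonicalState a' t' ↔ a = a' ∧ t = t' := by
  refine ⟨fun h => ?_, fun h => by rw [h.1, h.2]⟩
  have hcond (E : Op) : conditionalState (canonicalState a t) E
    = conditionalState (canonicalState a' t') E := by rw [h]
  refine ⟨funext fun i => ?_, funext fun i => ?_⟩
  · have htr := congrArg Matrix.trace (hcond (pauli i.succ))
    simpa [conditionalState_canonicalState, trace_pauli_mul_pauli, trace_pauli] using htr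
  · have htr := congrArg (fun X => (X * pauli i.succ).trace) (hcond (pauli i.succ))
    simpa [conditionalState_canonicalState, trace_pauli_mul_pauli, trace_pauli, add_mul,
      Matrix.sum_mul, Matrix.trace_sum] using htr

/-- Kraus operators of the extremal qubit channel with parameters `u`, `v`. -/
noncomputable def extremalKraus (u v : ℝ) : Fin 2 → Op :=
  ![!![Real.cos ((v - u) / 2), 0; 0, Real.cos ((v + u) / 2)],
    !![0, Real.sin ((v + u) / 2); Real.sin ((v - u) / 2), 0]]

theorem sum_conjTranspose_mul_extremalKraus (u v : ℝ) :
    ∑ i, (extremalKraus u v i).conjTranspose * extremalKraus u v i = 1 := by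
  have hcos_sin (x : ℝ) : (Real.cos x : ℂ) * Real.cos x + Real.sin x * Real.sin x = 1 := by
    exact_mod_cast (by ring : _ = _).trans (Real.cos_sq_add_sin_sq x)
  ext i j
  fin_cases i <;> fin_cases j <;>
    simp [extremalKraus, Matrix.mul_apply, Complex.conj_ofReal, hcos_sin, -Complex.ofReal_cos,
      -Complex.ofReal_sin]

theorem pauliMap_extremalMatrix (u v : ℝ) :
    pauliMap (extremalMatrix u v) = krausMap (extremalKraus u v) := by
  obtain ⟨x, y, rfl, rfl⟩ : ∃ x y, u = y - x ∧ v = y + x :=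
    ⟨(v - u) / 2, (v + u) / 2, by ring, by ring⟩
  have hx : Complex.sin x ^ 2 + Complex.cos x ^ 2 = 1 := Complex.sin_sq_add_cos_sq x
  have hy : Complex.sin y ^ 2 + Complex.cos y ^ 2 = 1 := Complex.sin_sq_add_cos_sq y
  have hI := Complex.I_sq
  ext X i j
  fin_cases i <;> fin_cases j <;>
    simp [pauliMap, krausMap, extremalMatrix, extremalKraus, Real.cos_sub,
      Real.cos_add, Real.sin_sub, Real.sin_add, pauli, Fin.sum_univ_succ, Matrix.trace,
      Matrix.mul_apply, ← Complex.cos_conj, ← Complex.sin_conj, -Matrix.cons_mul] <;>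
    grind

theorem pauliMap_sum_smul_pauli (M : Matrix (Fin 4) (Fin 4) ℝ) (c : Fin 4 → ℂ) :
    pauliMap M (∑ ν, c ν • pauli ν) = ∑ μ, (∑ ν, M μ ν * c ν) • pauli μ := by
  have hcoeff (ν) : (pauli ν * ∑ κ, c κ • pauli κ).trace / 2 = c ν := by
    simp [Finset.mul_sum, Matrix.trace_sum, trace_pauli_mul_pauli]
  simp only [pauliMap, hcoeff, Finset.sum_smul]

theorem applyAlice_extremalMatrix (u v : ℝ) (t : Fin 3 → ℝ) :
    applyAlice (pauliMap (extremalMatrix u v)) (canonicalState 0 t)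
      = canonicalState ![0, 0, Real.sin u * Real.sin v]
          ![Real.cos u * t 0, Real.cos v * t 1, Real.cos u * Real.cos v * t 2] := by
  have hpauli : pauli 0 = 1 := rfl
  ext ⟨i, j⟩ ⟨i', j'⟩
  have hblock : (fun i i' => canonicalState 0 t (i, j) (i', j')) =
      ∑ ν, (1 / 4 * (![1, t 0, t 1, t 2] ν : ℝ) * pauli ν j j') • pauli ν := by
    ext i i'
    simp [canonicalState_apply, Fin.sum_univ_succ, hpauli]
    ring
  change pauliMap _ (fun i i' => canonicalState 0 t (i, j) (i', j')) i i' = _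
  rw [hblock, pauliMap_sum_smul_pauli]
  simp [canonicalState_apply, extremalMatrix, Fin.sum_univ_succ, hpauli]
  ring

theorem trace_mul_nonneg {n : Type*} [Fintype n] {A B : Matrix n n ℂ} (hA : A.PosSemidef)
    (hB : B.PosSemidef) : 0 ≤ (A * B).trace := by
  classical
  obtain ⟨C, rfl⟩ : ∃ C : Matrix n n ℂ, A = C.conjTranspose * C := by
    open scoped MatrixOrder Matrix.Norms.L2Operator in
    exact CStarAlgebra.nonneg_iff_eq_star_mul_self.1 hA.nonneg
  rw [mul_assoc, Matrix.trace_mul_comm]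
  exact (hB.mul_mul_conjTranspose_same C).trace_nonneg

/-- The expectation `Tr(S ρ)` of the operator `S` that swaps the two qubits. -/
def swapTrace : Op2 →ₗ[ℂ] ℂ where
  toFun ρ := ∑ i, ∑ j, ρ (i, j) (j, i)
  map_add' ρ τ := by simp only [Matrix.add_apply, Finset.sum_add_distrib]
  map_smul' c ρ := by simp only [Matrix.smul_apply, Finset.smul_sum, RingHom.id_apply]

theorem swapTrace_kronecker (A B : Op) : swapTrace (A ⊗ₖ B) = (A * B).trace := by
  simp only [swapTrace, LinearMap.coe_mk, AddHom.coe_mk, Matrix.kronecker_apply, Matrix.trace,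
    Matrix.diag_apply, Matrix.mul_apply]

theorem swapTrace_canonicalState (a t : Fin 3 → ℝ) :
    swapTrace (canonicalState a t) = ((1 + ∑ i, t i) / 2 : ℝ) := by
  simp only [canonicalState, map_smul, map_add, map_sum, swapTrace_kronecker, mul_one, trace_pauli,
    trace_pauli_mul_pauli, Matrix.trace_one, Fintype.card_fin, Fin.succ_ne_zero, if_false, if_true,
    smul_eq_mul, mul_zero, Finset.sum_const_zero, ← Finset.sum_mul]
  push_cast
  ring

theorem IsSeparable.zero_le_swapTrace {ρ : Op2} (h : IsSeparable ρ) : 0 ≤ swapTrace ρ := by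
  refine convexHull_min ?_ ((convex_Ici (0 : ℂ)).linear_preimage (swapTrace.restrictScalars ℝ)) h
  rintro _ ⟨A, B, hA, hB, rfl⟩
  have hnonneg := trace_mul_nonneg hA.1 hB.1
  rwa [← swapTrace_kronecker] at hnonneg

theorem sum_nonneg_of_isSeparable_canonicalState {a t : Fin 3 → ℝ}
    (h : IsSeparable (canonicalState a t)) : 0 ≤ 1 + ∑ i, t i := by
  have hswap := h.zero_le_swapTrace
  rw [swapTrace_canonicalState, Complex.zero_le_real] at hswap
  linarith

theorem isState_canonicalState {a s q : ℝ} (hq : |a| ≤ 1 + q) (hq' : q ≤ 1)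
    (hs : a ^ 2 + (2 * s) ^ 2 ≤ (1 - q) ^ 2) :
    IsState (canonicalState ![0, 0, a] ![s, s, q]) := by
  -- The operator is the sum of a block `A` on `|00⟩, |11⟩` and a block `A'` on `|01⟩, |10⟩`.
  let J : Matrix (Fin 2 × Fin 2) (Fin 2) ℂ := Matrix.of fun x i => if x = (i, i) then 1 else 0
  let J' : Matrix (Fin 2 × Fin 2) (Fin 2) ℂ :=
    Matrix.of fun x i => if x = (i, 1 - i) then 1 else 0
  let A : Op := !![((1 + q + a) / 4 : ℝ), (0 : ℝ); star (0 : ℝ), ((1 + q - a) / 4 : ℝ)]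
  let A' : Op :=
    !![((1 - q + a) / 4 : ℝ), (s / 2 : ℝ); star ((s / 2 : ℝ) : ℂ), ((1 - q - a) / 4 : ℝ)]
  have hA : A.PosSemidef := posSemidef_fin_two (by linarith [abs_nonneg a]) (by
    rw [Complex.normSq_ofReal]
    nlinarith [abs_le.1 hq])
  have hA' : A'.PosSemidef := posSemidef_fin_two (by linarith) (by
    rw [Complex.normSq_ofReal]
    linarith)
  have hsum : canonicalState ![0, 0, a] ![s, s, q] =
      J * A * J.conjTranspose + J' * A' * J'.conjTranspose := by
    ext ⟨i, j⟩ ⟨i', j'⟩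
    fin_cases i <;> fin_cases i' <;> fin_cases j <;> fin_cases j' <;>
      simp [canonicalState_apply, pauli, Fin.sum_univ_succ, J, J', A, A', Matrix.mul_apply] <;>
      ring
  constructor
  · rw [hsum]
    exact (hA.mul_mul_conjTranspose_same J).add (hA'.mul_mul_conjTranspose_same J')
  · rw [Matrix.trace, Fintype.sum_prod_type]
    simp [canonicalState_apply, pauli, Fin.sum_univ_succ]
    ring

/-! ### Integrals over the unit ball -/

/-- The space of Bloch vectors. -/
abbrev Space := EuclideanSpace ℝ (Fin 3)

/-- The cylindrical splitting `(z, (x, y))` of Euclidean space into its polar axis and its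
equatorial plane. -/
noncomputable def cylinderEquiv : Space ≃ᵐ ℝ × (ℝ × ℝ) :=
  (MeasurableEquiv.toLp 2 (Fin 3 → ℝ)).symm.trans
    ((MeasurableEquiv.piFinSuccAbove (fun _ => ℝ) 2).trans
      (MeasurableEquiv.prodCongr (MeasurableEquiv.refl ℝ) MeasurableEquiv.finTwoArrow))

theorem measurePreserving_cylinderEquiv : MeasurePreserving cylinderEquiv :=
  (((MeasurePreserving.id volume).prod (volume_preserving_finTwoArrow ℝ)).comp
    (volume_preserving_piFinSuccAbove (fun _ : Fin 3 => ℝ) 2)).comp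
    (EuclideanSpace.volume_preserving_symm_measurableEquiv_toLp (Fin 3))

theorem cylinderEquiv_symm_apply (z x y : ℝ) :
    cylinderEquiv.symm (z, (x, y)) = !₂[x, y, z] := by
  rw [MeasurableEquiv.symm_apply_eq]
  rfl

theorem lintegral_eq_lintegral_cylinder {f : Space → ENNReal} (hf : Measurable f) :
    ∫⁻ y, f y = ∫⁻ φ in Set.Ioo (-Real.pi) Real.pi, ∫⁻ x in {x : ℝ × ℝ | 0 < x.2},
      ENNReal.ofReal x.2 * f !₂[x.2 * Real.cos φ, x.2 * Real.sin φ, x.1] := by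
  let g (z ρ φ : ℝ) : ENNReal :=
    ENNReal.ofReal ρ * f (cylinderEquiv.symm (z, ρ * Real.cos φ, ρ * Real.sin φ))
  have hset : {x : ℝ × ℝ | 0 < x.2} = Set.univ ×ˢ Set.Ioi 0 := by ext; simp
  simp_rw [hset, ← cylinderEquiv_symm_apply]
  calc
    ∫⁻ y, f y = ∫⁻ x, f (cylinderEquiv.symm x) :=
      (measurePreserving_cylinderEquiv.symm.lintegral_comp hf).symm
    _ = ∫⁻ z, ∫⁻ w, f (cylinderEquiv.symm (z, w)) :=
      lintegral_prod _ (by fun_prop)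
    _ = ∫⁻ z, ∫⁻ w in Set.Ioi 0 ×ˢ Set.Ioo (-Real.pi) Real.pi, g z w.1 w.2 := by
      simp_rw [← lintegral_comp_polarCoord_symm, polarCoord_target, polarCoord_symm_apply,
        smul_eq_mul, g]
    _ = ∫⁻ z, ∫⁻ φ in Set.Ioo (-Real.pi) Real.pi, ∫⁻ ρ in Set.Ioi 0, g z ρ φ :=
      lintegral_congr fun z => setLIntegral_prod_symm _ (by fun_prop)
    _ = ∫⁻ φ in Set.Ioo (-Real.pi) Real.pi, ∫⁻ z, ∫⁻ ρ in Set.Ioi 0, g z ρ φ :=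
      lintegral_lintegral_swap (by fun_prop)
    _ = ∫⁻ φ in Set.Ioo (-Real.pi) Real.pi, ∫⁻ x in Set.univ ×ˢ Set.Ioi 0, g x.1 x.2 φ := by
      simp_rw [Measure.volume_eq_prod]
      refine lintegral_congr fun φ => ?_
      rw [setLIntegral_prod _ (by fun_prop), Measure.restrict_univ]

theorem lintegral_halfPlane_polar (g : ℝ × ℝ → ENNReal) :
    ∫⁻ x in {x : ℝ × ℝ | 0 < x.2}, g x = ∫⁻ x in Set.Ioi 0 ×ˢ Set.Ioo 0 Real.pi,
      ENNReal.ofReal x.1 * g (x.1 * Real.cos x.2, x.1 * Real.sin x.2) := by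
  have hsub : Set.Ioi (0 : ℝ) ×ˢ Set.Ioo 0 Real.pi ⊆ polarCoord.target :=
    Set.prod_mono subset_rfl (Set.Ioo_subset_Ioo_left (by linarith [Real.pi_pos]))
  have hsin {x : ℝ × ℝ} (hx : x ∈ polarCoord.target) :
      0 < x.1 * Real.sin x.2 ↔ x ∈ Set.Ioi (0 : ℝ) ×ˢ Set.Ioo 0 Real.pi := by
    obtain ⟨hr, hθ⟩ := hx
    rw [mul_pos_iff_of_pos_left hr]
    refine ⟨fun h => ⟨hr, ?_, hθ.2⟩, fun h => Real.sin_pos_of_mem_Ioo h.2⟩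
    contrapose! h
    exact Real.sin_nonpos_of_nonpos_of_neg_pi_le h hθ.1.le
  have hmem {x : ℝ × ℝ} (hx : x ∈ polarCoord.target) :
      polarCoord.symm x ∈ {x : ℝ × ℝ | 0 < x.2} ↔ x ∈ Set.Ioi (0 : ℝ) ×ˢ Set.Ioo 0 Real.pi :=
    hsin hx
  rw [← lintegral_indicator (measurableSet_lt measurable_const measurable_snd),
    ← lintegral_comp_polarCoord_symm, ← Set.inter_eq_self_of_subset_left hsub,
    ← setLIntegral_indicator (measurableSet_Ioi.prod measurableSet_Ioo)]
  refine setLIntegral_congr_fun polarCoord.open_target.measurableSet fun x hx => ?_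
  by_cases h : x ∈ Set.Ioi (0 : ℝ) ×ˢ Set.Ioo 0 Real.pi
  · rw [Set.indicator_of_mem h, Set.indicator_of_mem ((hmem hx).2 h)]
    rfl
  · rw [Set.indicator_of_notMem h, Set.indicator_of_notMem (mt (hmem hx).1 h), smul_zero]

theorem lintegral_eq_lintegral_spherical {f : Space → ENNReal} (hf : Measurable f) :
    ∫⁻ y, f y = ∫⁻ φ in Set.Ioo (-Real.pi) Real.pi, ∫⁻ x in Set.Ioi 0 ×ˢ Set.Ioo 0 Real.pi,
      ENNReal.ofReal (x.1 ^ 2 * Real.sin x.2) * f (WithLp.toLp 2 (sph x.1 x.2 φ)) := by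
  rw [lintegral_eq_lintegral_cylinder hf]
  refine lintegral_congr fun φ => ?_
  rw [lintegral_halfPlane_polar]
  refine setLIntegral_congr_fun (measurableSet_Ioi.prod measurableSet_Ioo) fun x hx => ?_
  simp only
  rw [← mul_assoc, ← ENNReal.ofReal_mul (Set.mem_Ioi.1 hx.1).le, ← mul_assoc, ← sq]
  rfl

theorem toLp_sph (r θ φ : ℝ) : WithLp.toLp 2 (sph r θ φ) = r • WithLp.toLp 2 (sph 1 θ φ) := by
  ext i
  fin_cases i <;> simp [sph, mul_assoc]

theorem norm_toLp_sph (r θ φ : ℝ) : ‖WithLp.toLp 2 (sph r θ φ)‖ = |r| := by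
  rw [← abs_of_nonneg (norm_nonneg _), ← sq_eq_sq_iff_abs_eq_abs, EuclideanSpace.real_norm_sq_eq,
    Fin.sum_univ_three]
  simp only [sph, Matrix.cons_val]
  linear_combination r ^ 2 * Real.sin θ ^ 2 * Real.sin_sq_add_cos_sq φ
    + r ^ 2 * Real.sin_sq_add_cos_sq θ

theorem setLIntegral_Ioo_ofReal {a b : ℝ} (hab : a ≤ b) {g : ℝ → ℝ} (hg : Continuous g)
    (h0 : ∀ x ∈ Set.Ioo a b, 0 ≤ g x) :
    ∫⁻ x in Set.Ioo a b, ENNReal.ofReal (g x) = ENNReal.ofReal (∫ x in a..b, g x) := by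
  rw [← ofReal_integral_eq_lintegral_ofReal (hg.integrableOn_Icc.mono_set Set.Ioo_subset_Icc_self)
    ((ae_restrict_iff' measurableSet_Ioo).2 (ae_of_all _ h0)), ← integral_Ioc_eq_integral_Ioo,
    ← intervalIntegral.integral_of_le hab]

theorem setLIntegral_ball_of_homogeneous {f : Space → ENNReal} (hf : Measurable f)
    (hhom : ∀ r : ℝ, 0 < r → ∀ y, f (r • y) = ENNReal.ofReal r * f y) :
    ∫⁻ y in Metric.ball 0 1, f y = ENNReal.ofReal (1 / 4) *
      ∫⁻ φ in Set.Ioo (-Real.pi) Real.pi, ∫⁻ θ in Set.Ioo 0 Real.pi,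
        ENNReal.ofReal (Real.sin θ) * f (WithLp.toLp 2 (sph 1 θ φ)) := by
  have hradial : ENNReal.ofReal (1 / 4) = ∫⁻ r in Set.Ioo (0 : ℝ) 1, ENNReal.ofReal (r ^ 3) := by
    rw [setLIntegral_Ioo_ofReal zero_le_one (continuous_pow 3) fun r hr => pow_nonneg hr.1.le 3,
      integral_pow]
    norm_num
  have hset : Set.Ioo (0 : ℝ) 1 ×ˢ Set.Ioo 0 Real.pi
      = {x : ℝ × ℝ | x.1 < 1} ∩ Set.Ioi 0 ×ˢ Set.Ioo 0 Real.pi := by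
    ext
    simp [and_left_comm, and_assoc]
  have hmeas (φ : ℝ) :
      Measurable fun θ => ENNReal.ofReal (Real.sin θ) * f (WithLp.toLp 2 (sph 1 θ φ)) :=
    Measurable.mul (by fun_prop) (hf.comp (by unfold sph; fun_prop))
  rw [← lintegral_indicator measurableSet_ball,
    lintegral_eq_lintegral_spherical (hf.indicator measurableSet_ball),
    ← lintegral_const_mul' _ _ ENNReal.ofReal_ne_top]
  refine lintegral_congr fun φ => ?_
  rw [hradial, ← lintegral_prod_mul (by fun_prop) (hmeas φ).aemeasurable, Measure.prod_restrict,
    ← Measure.volume_eq_prod, hset,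
    ← setLIntegral_indicator (measurableSet_lt measurable_fst measurable_const)]
  refine setLIntegral_congr_fun (measurableSet_Ioi.prod measurableSet_Ioo) fun x hx => ?_
  have hr : 0 < x.1 := hx.1
  have hball : WithLp.toLp 2 (sph x.1 x.2 φ) ∈ Metric.ball (0 : Space) 1
      ↔ x ∈ {x : ℝ × ℝ | x.1 < 1} := by
    rw [mem_ball_zero_iff, norm_toLp_sph, abs_of_pos hr, Set.mem_ofPred_eq]
  by_cases h : x ∈ {x : ℝ × ℝ | x.1 < 1}
  · simp only [Set.indicator_of_mem h, Set.indicator_of_mem (hball.2 h)]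
    rw [toLp_sph, hhom _ hr, ← mul_assoc, ← mul_assoc, ← ENNReal.ofReal_mul' hr.le,
      ← ENNReal.ofReal_mul (by positivity)]
    ring_nf
  · simp only [Set.indicator_of_notMem h, Set.indicator_of_notMem (mt hball.1 h), mul_zero]

theorem integral_ball_of_homogeneous {f : Space → ℝ} (hf : Continuous f) (h0 : ∀ y, 0 ≤ f y)
    (hhom : ∀ r : ℝ, 0 < r → ∀ y, f (r • y) = r * f y) :
    ∫ y in Metric.ball 0 1, f y = 1 / 4 * ∫ φ in (0 : ℝ)..(2 * Real.pi),
      ∫ θ in (0 : ℝ)..Real.pi, f (WithLp.toLp 2 (sph 1 θ φ)) * Real.sin θ := by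
  have hsph : Continuous fun x : ℝ × ℝ => sph 1 x.2 x.1 := by
    unfold sph
    fun_prop
  let g (φ θ : ℝ) : ℝ := f (WithLp.toLp 2 (sph 1 θ φ)) * Real.sin θ
  let h (φ : ℝ) : ℝ := ∫ θ in (0 : ℝ)..Real.pi, g φ θ
  have hg : Continuous (Function.uncurry g) := by
    unfold g Function.uncurry
    fun_prop
  have hg_nonneg (φ : ℝ) {θ : ℝ} (hθ : θ ∈ Set.Icc 0 Real.pi) : 0 ≤ g φ θ :=
    mul_nonneg (h0 _) (Real.sin_nonneg_of_mem_Icc hθ)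
  have hh : Continuous h :=
    intervalIntegral.continuous_parametric_intervalIntegral_of_continuous' hg 0 Real.pi
  have hh_nonneg (φ : ℝ) : 0 ≤ h φ :=
    intervalIntegral.integral_nonneg Real.pi_pos.le fun θ hθ => hg_nonneg φ hθ
  have hh_periodic : ∫ φ in -Real.pi..Real.pi, h φ = ∫ φ in (0 : ℝ)..(2 * Real.pi), h φ := by
    have hperiodic : Function.Periodic h (2 * Real.pi) := fun φ => by simp [h, g, sph]
    have := hperiodic.intervalIntegral_add_eq (-Real.pi) 0
    rwa [zero_add, show -Real.pi + 2 * Real.pi = Real.pi by ring] at this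
  have hsphere (φ : ℝ) : ∫⁻ θ in Set.Ioo 0 Real.pi,
      ENNReal.ofReal (Real.sin θ) * ENNReal.ofReal (f (WithLp.toLp 2 (sph 1 θ φ)))
        = ENNReal.ofReal (h φ) := by
    simp_rw [← ENNReal.ofReal_mul' (h0 _), mul_comm (Real.sin _)]
    exact setLIntegral_Ioo_ofReal Real.pi_pos.le (hg.uncurry_left φ) fun θ hθ =>
      hg_nonneg φ (Set.Ioo_subset_Icc_self hθ)
  rw [integral_eq_lintegral_of_nonneg_ae (ae_of_all _ h0) hf.aestronglyMeasurable,
    setLIntegral_ball_of_homogeneous (by fun_prop) fun r hr y => by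
      rw [hhom r hr, ENNReal.ofReal_mul hr.le]]
  simp_rw [hsphere]
  rw [setLIntegral_Ioo_ofReal (by linarith [Real.pi_pos]) hh fun φ _ => hh_nonneg φ,
    hh_periodic, ← ENNReal.ofReal_mul (by norm_num), ENNReal.toReal_ofReal]
  exact mul_nonneg (by norm_num)
    (intervalIntegral.integral_nonneg (by positivity) fun φ _ => hh_nonneg φ)

theorem measurable_realSign : Measurable Real.sign :=
  Measurable.ite measurableSet_Iio measurable_const
    (Measurable.ite measurableSet_Ioi measurable_const measurable_const)

theorem abs_realSign_le_one (x : ℝ) : |Real.sign x| ≤ 1 := by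
  rcases Real.sign_apply_eq x with h | h | h <;> simp [h]

theorem realSign_mul_self (x : ℝ) : Real.sign x * x = |x| := by
  rcases lt_trichotomy x 0 with h | rfl | h
  · rw [Real.sign_of_neg h, abs_of_neg h, neg_one_mul]
  · simp
  · rw [Real.sign_of_pos h, abs_of_pos h, one_mul]

section UnitBall

variable {E F : Type*} [NormedAddCommGroup E] [InnerProductSpace ℝ E] [FiniteDimensional ℝ E]
  [MeasurableSpace E] [BorelSpace E] [NormedAddCommGroup F]

theorem integrableOn_ball_of_continuous {f : E → F} (hf : Continuous f) :
    IntegrableOn f (Metric.ball 0 1) :=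
  (hf.continuousOn.integrableOn_compact (isCompact_closedBall 0 1)).mono_set
    Metric.ball_subset_closedBall

variable [NormedSpace ℝ F]

theorem integral_ball_comp_linearIsometryEquiv (R : E ≃ₗᵢ[ℝ] E) (f : E → F) :
    ∫ y in Metric.ball 0 1, f (R y) = ∫ y in Metric.ball 0 1, f y := by
  have h := R.measurePreserving.setIntegral_preimage_emb
    R.toHomeomorph.measurableEmbedding f (Metric.ball 0 1)
  rwa [LinearIsometryEquiv.preimage_ball, map_zero] at h

theorem integral_ball_eq_zero_of_odd {f : E → F} (hf : ∀ y, f (-y) = -f y) :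
    ∫ y in Metric.ball 0 1, f y = 0 := by
  have h := integral_ball_comp_linearIsometryEquiv (LinearIsometryEquiv.neg ℝ) f
  simp only [LinearIsometryEquiv.coe_neg, hf, integral_neg] at h
  rwa [neg_eq_iff_add_eq_zero, ← two_smul ℝ, smul_eq_zero_iff_right two_ne_zero] at h

theorem integrableOn_ball_sign_smul (m : E) {f : E → F} (hf : Continuous f) :
    IntegrableOn (fun y => Real.sign (inner ℝ y m) • f y) (Metric.ball 0 1) := by
  refine (integrableOn_ball_of_continuous hf).bdd_smul (C := 1) ?_ (ae_of_all _ fun y => ?_)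
  · exact (measurable_realSign.comp (by fun_prop)).aestronglyMeasurable
  · exact abs_realSign_le_one _

theorem integral_ball_abs_inner (x : E) {e : E} (he : ‖e‖ = 1) :
    ∫ y in Metric.ball 0 1, |inner ℝ y x| = ‖x‖ * ∫ y in Metric.ball 0 1, |inner ℝ y e| := by
  have hnorm : ‖‖x‖ • e‖ = ‖x‖ := by rw [norm_smul, norm_norm, he, mul_one]
  let R := (ℝ ∙ (‖x‖ • e - x))ᗮ.reflection
  have hR : R (‖x‖ • e) = x := Submodule.reflection_sub hnorm
  rw [← integral_ball_comp_linearIsometryEquiv R, ← integral_const_mul]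
  refine integral_congr_ae (ae_of_all _ fun y => ?_)
  have hinner : inner ℝ (R y) x = ‖x‖ * inner ℝ y e := by
    rw [← inner_smul_right, ← R.inner_map_map y, hR]
  simp only [hinner, abs_mul, abs_norm]

theorem norm_smul_integral_ball_sign_smul (m : E) {e : E} (he : ‖e‖ = 1) :
    ‖m‖ • ∫ y in Metric.ball 0 1, Real.sign (inner ℝ y m) • y
      = (∫ y in Metric.ball 0 1, |inner ℝ y e|) • m := by
  rcases eq_or_ne m 0 with rfl | hm
  · simp
  -- The moment is fixed by the reflection in the line `ℝ ∙ m`, hence a multiple of `m`.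
  let R := (ℝ ∙ m).reflection
  have hRm : R m = m :=
    Submodule.reflection_mem_subspace_eq_self (Submodule.mem_span_singleton_self m)
  have hfixed : R (∫ y in Metric.ball 0 1, Real.sign (inner ℝ y m) • y)
      = ∫ y in Metric.ball 0 1, Real.sign (inner ℝ y m) • y := by
    rw [← R.coe_toContinuousLinearEquiv, ← R.toContinuousLinearEquiv.integral_comp_comm,
      ← integral_ball_comp_linearIsometryEquiv R]
    refine integral_congr_ae (ae_of_all _ fun y => ?_)
    have hinv : inner ℝ (R y) m = inner ℝ y m :=
      (congrArg _ hRm.symm).trans (R.inner_map_map y m)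
    simp only [map_smul, R.coe_toContinuousLinearEquiv, hinv, R, Submodule.reflection_reflection]
  obtain ⟨c, hc⟩ := Submodule.mem_span_singleton.1
    ((Submodule.reflection_eq_self_iff _).1 hfixed)
  have hinner : c * ‖m‖ ^ 2 = ‖m‖ * ∫ y in Metric.ball 0 1, |inner ℝ y e| := by
    rw [← real_inner_self_eq_norm_sq, ← inner_smul_right, hc,
      ← integral_inner (integrableOn_ball_sign_smul m continuous_id'),
      ← integral_ball_abs_inner m he]
    refine integral_congr_ae (ae_of_all _ fun y => ?_)
    simp only [inner_smul_right, real_inner_comm]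
    exact realSign_mul_self _
  rw [← hc, smul_smul]
  congr 1
  have : ‖m‖ ≠ 0 := norm_ne_zero_iff.2 hm
  field_simp at hinner
  rw [← hinner, mul_comm]

end UnitBall

/-! ### The border integral -/

/-- The operator `diag t` on Bloch vectors. -/
noncomputable def diagMap (t : Fin 3 → ℝ) : Space →L[ℝ] Space :=
  Matrix.toEuclideanCLM (𝕜 := ℝ) (Matrix.diagonal t)

theorem diagMap_apply (t : Fin 3 → ℝ) (y : Space) (i : Fin 3) : diagMap t y i = t i * y i := by
  simp [diagMap, Matrix.mulVec_diagonal]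

theorem norm_diagMap (t : Fin 3 → ℝ) (y : Space) :
    ‖diagMap t y‖ = √(∑ i, t i ^ 2 * y i ^ 2) := by
  simp only [EuclideanSpace.norm_eq, diagMap_apply, Real.norm_eq_abs, sq_abs, mul_pow]

/-- The left-hand side of the border equation of T-states for `T = diag t`. -/
noncomputable def borderIntegral (t : Fin 3 → ℝ) : ℝ :=
  1 / (2 * Real.pi) *
    ∫ φ in (0 : ℝ)..(2 * Real.pi), ∫ θ in (0 : ℝ)..Real.pi,
      √(∑ i, t i ^ 2 * sph 1 θ φ i ^ 2) * Real.sin θ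

theorem integral_ball_norm_diagMap (t : Fin 3 → ℝ) :
    ∫ y in Metric.ball 0 1, ‖diagMap t y‖ = Real.pi / 2 * borderIntegral t := by
  rw [integral_ball_of_homogeneous (by fun_prop) (fun y => norm_nonneg _) fun r hr y => by
    rw [map_smul, norm_smul, Real.norm_of_nonneg hr.le], borderIntegral, ← mul_assoc]
  simp only [norm_diagMap]
  congr 1
  field_simp
  norm_num

theorem borderIntegral_eq_integral {t : Fin 3 → ℝ} {p : ℝ} (h0 : t 0 ^ 2 = p ^ 2)
    (h1 : t 1 ^ 2 = p ^ 2) :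
    borderIntegral t = ∫ x in (-1 : ℝ)..1, √(p ^ 2 * (1 - x ^ 2) + t 2 ^ 2 * x ^ 2) := by
  have hsph (φ θ : ℝ) : √(∑ i, t i ^ 2 * sph 1 θ φ i ^ 2) * Real.sin θ
      = -(√(p ^ 2 * (1 - Real.cos θ ^ 2) + t 2 ^ 2 * Real.cos θ ^ 2) * -Real.sin θ) := by
    rw [mul_neg, neg_neg, ← Real.sin_sq, Fin.sum_univ_three, h0, h1]
    congr 2
    simp only [sph, Matrix.cons_val]
    linear_combination p ^ 2 * Real.sin θ ^ 2 * Real.sin_sq_add_cos_sq φ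
  have hsubst := intervalIntegral.integral_comp_mul_deriv (a := 0) (b := Real.pi)
    (g := fun x => √(p ^ 2 * (1 - x ^ 2) + t 2 ^ 2 * x ^ 2))
    (fun x _ => Real.hasDerivAt_cos x) (by fun_prop) (by fun_prop)
  rw [Real.cos_zero, Real.cos_pi, intervalIntegral.integral_symm (-1) 1] at hsubst
  simp only [Function.comp_apply] at hsubst
  simp only [borderIntegral, hsph, intervalIntegral.integral_neg, hsubst, neg_neg,
    intervalIntegral.integral_const, sub_zero, smul_eq_mul]
  rw [← mul_assoc, one_div_mul_cancel (by positivity), one_mul]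

theorem integral_abs_neg_one_one : ∫ x in (-1 : ℝ)..1, |x| = 1 := by
  have hpos : ∫ x in (0 : ℝ)..1, |x| = 1 / 2 := by
    have hcongr : Set.EqOn (fun x : ℝ => |x|) id (Set.uIcc 0 1) := fun x hx =>
      abs_of_nonneg (Set.uIcc_of_le (zero_le_one' ℝ) ▸ hx).1
    rw [intervalIntegral.integral_congr hcongr]
    simp
  have hneg : ∫ x in (-1 : ℝ)..0, |x| = ∫ x in (0 : ℝ)..1, |x| := by
    simpa using intervalIntegral.integral_comp_neg (a := -1) (b := 0) fun x : ℝ => |x|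
  rw [← intervalIntegral.integral_add_adjacent_intervals (b := 0)
    (continuous_abs.intervalIntegrable _ _) (continuous_abs.intervalIntegrable _ _), hneg, hpos]
  norm_num

theorem borderIntegral_of_eq_zero {t : Fin 3 → ℝ} (h0 : t 0 = 0) (h1 : t 1 = 0) :
    borderIntegral t = |t 2| := by
  rw [borderIntegral_eq_integral (p := 0) (by rw [h0]) (by rw [h1])]
  simp only [ne_eq, OfNat.ofNat_ne_zero, not_false_eq_true, zero_pow, zero_mul, zero_add,
    ← mul_pow, Real.sqrt_sq_eq_abs, abs_mul, intervalIntegral.integral_const_mul,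
    integral_abs_neg_one_one, mul_one]

theorem one_add_mul_sq_pos {c x : ℝ} (hc : -1 ≤ c) (hx : x ∈ Set.Ioo (-1 : ℝ) 1) :
    0 < 1 + c * x ^ 2 := by
  have : x ^ 2 < 1 := (sq_lt_one_iff_abs_lt_one _).2 (abs_lt.2 hx)
  nlinarith [sq_nonneg x]

theorem integral_sqrt_one_add_mul_sq {c : ℝ} (hc : -1 ≤ c) {G : ℝ → ℝ} (hG : Continuous G)
    (hd : ∀ x ∈ Set.Ioo (-1 : ℝ) 1, HasDerivAt G (1 / √(1 + c * x ^ 2)) x) :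
    ∫ x in (-1 : ℝ)..1, √(1 + c * x ^ 2) = √(1 + c) + (G 1 - G (-1)) / 2 := by
  have hF (x : ℝ) (hx : x ∈ Set.Ioo (-1 : ℝ) 1) :
      HasDerivAt (fun x => (x * √(1 + c * x ^ 2) + G x) / 2) (√(1 + c * x ^ 2)) x := by
    have hpos := one_add_mul_sq_pos hc hx
    have hsq : HasDerivAt (fun x => 1 + c * x ^ 2) (c * (2 * x)) x := by
      simpa using ((hasDerivAt_pow 2 x).const_mul c).const_add 1
    refine ((((hasDerivAt_id x).mul (hsq.sqrt hpos.ne')).add (hd x hx)).div_const 2).congr_deriv ?_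
    have hne : √(1 + c * x ^ 2) ≠ 0 := (Real.sqrt_pos.2 hpos).ne'
    have hself := Real.sq_sqrt hpos.le
    simp only [id]
    field_simp
    linear_combination -hself
  rw [intervalIntegral.integral_eq_sub_of_hasDerivAt_of_le (by norm_num)
    (Continuous.continuousOn (by fun_prop)) hF (Continuous.intervalIntegrable (by fun_prop) _ _)]
  ring_nf

theorem integral_sqrt_eq_bracket_of_neg {c : ℝ} (hc : -1 ≤ c) (h : c < 0) :
    ∫ x in (-1 : ℝ)..1, √(1 + c * x ^ 2) = bracket c := by
  have hs : 0 < √(-c) := Real.sqrt_pos.2 (by linarith)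
  have hsq : √(-c) ^ 2 = -c := Real.sq_sqrt (by linarith)
  rw [integral_sqrt_one_add_mul_sq hc
    (G := fun x => 1 / √(-c) * Real.arcsin (√(-c) * x)) (by fun_prop)]
  · simp only [bracket, if_pos h, mul_one, mul_neg, Real.arcsin_neg]
    ring
  · intro x hx
    have hlt : (√(-c) * x) ^ 2 < 1 := by
      rw [mul_pow, hsq]
      linarith [one_add_mul_sq_pos hc hx]
    obtain ⟨hgt, hlt⟩ := abs_lt.1 ((sq_lt_one_iff_abs_lt_one _).1 hlt)
    refine (((Real.hasDerivAt_arcsin hgt.ne' hlt.ne).comp x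
      ((hasDerivAt_id x).const_mul √(-c))).const_mul (1 / √(-c))).congr_deriv ?_
    rw [mul_pow, hsq, neg_mul, sub_neg_eq_add]
    field_simp

theorem integral_sqrt_eq_bracket_of_pos {c : ℝ} (h : 0 < c) :
    ∫ x in (-1 : ℝ)..1, √(1 + c * x ^ 2) = bracket c := by
  have hsq : √c ^ 2 = c := Real.sq_sqrt h.le
  have hlog : Real.log ((√(1 + c) + √c) / (√(1 + c) - √c)) = 2 * Real.arsinh √c := by
    have hsq' : √(1 + c) ^ 2 = 1 + c := Real.sq_sqrt (by linarith)
    have hlt : √c < √(1 + c) := Real.sqrt_lt_sqrt h.le (by linarith)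
    have hquot : (√(1 + c) + √c) / (√(1 + c) - √c) = (√c + √(1 + c)) ^ 2 := by
      rw [div_eq_iff (by linarith)]
      linear_combination (√c + √(1 + c)) * (hsq - hsq')
    rw [Real.arsinh, hsq, hquot, Real.log_pow, Nat.cast_ofNat]
  have hcont := Real.continuous_arsinh
  rw [integral_sqrt_one_add_mul_sq (by linarith)
    (G := fun x => 1 / √c * Real.arsinh (√c * x)) (by fun_prop)]
  · simp only [bracket, if_neg h.not_gt, if_neg h.ne', hlog, mul_one, mul_neg, Real.arsinh_neg]
    ring
  · intro x _
    refine (((Real.hasDerivAt_arsinh (√c * x)).comp x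
      ((hasDerivAt_id x).const_mul √c)).const_mul (1 / √c)).congr_deriv ?_
    have hs : √c ≠ 0 := (Real.sqrt_pos.2 h).ne'
    rw [mul_pow, hsq]
    field_simp

theorem integral_sqrt_eq_bracket {c : ℝ} (hc : -1 ≤ c) :
    ∫ x in (-1 : ℝ)..1, √(1 + c * x ^ 2) = bracket c := by
  rcases lt_trichotomy c 0 with h | rfl | h
  · exact integral_sqrt_eq_bracket_of_neg hc h
  · norm_num [bracket]
  · exact integral_sqrt_eq_bracket_of_pos h

theorem bracket_pos {c : ℝ} (hc : -1 ≤ c) : 0 < bracket c := by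
  rw [← integral_sqrt_eq_bracket hc]
  exact intervalIntegral.intervalIntegral_pos_of_pos_on
    (Continuous.intervalIntegrable (by fun_prop) _ _)
    (fun x hx => Real.sqrt_pos.2 (one_add_mul_sq_pos hc hx)) (by norm_num)

theorem borderIntegral_eq_bracket {t : Fin 3 → ℝ} {p : ℝ} (hp : 0 < p) (h0 : t 0 ^ 2 = p ^ 2)
    (h1 : t 1 ^ 2 = p ^ 2) : borderIntegral t = p * bracket (t 2 ^ 2 / p ^ 2 - 1) := by
  have hc : -1 ≤ t 2 ^ 2 / p ^ 2 - 1 := by linarith [show 0 ≤ t 2 ^ 2 / p ^ 2 by positivity]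
  rw [borderIntegral_eq_integral h0 h1, ← integral_sqrt_eq_bracket hc,
    ← intervalIntegral.integral_const_mul]
  congr 1 with x
  nth_rw 2 [← Real.sqrt_sq hp.le]
  rw [← Real.sqrt_mul (sq_nonneg p)]
  congr 1
  field_simp
  ring

/-! ### The hidden state model of T-states -/

section SignResponse

variable {E F : Type*} [NormedAddCommGroup E] [InnerProductSpace ℝ E] [NormedAddCommGroup F]
  [NormedSpace ℝ F]

/-- The response of Alice to the effect `(τ + v·σ) / 2` when the hidden variable is `y`: up to a
bias, she answers with the sign of `y·v`. -/
noncomputable def response (τ : ℝ) (v y : E) : ℝ :=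
  (τ + ‖v‖ * Real.sign (inner ℝ y v)) / 2

theorem response_mem_Icc {τ : ℝ} {v : E} (h : ‖v‖ ≤ τ) (h' : ‖v‖ ≤ 2 - τ) (y : E) :
    response τ v y ∈ Set.Icc 0 1 := by
  have habs : |‖v‖ * Real.sign (inner ℝ y v)| ≤ ‖v‖ := by
    rw [abs_mul, abs_norm]
    exact mul_le_of_le_one_right (norm_nonneg v) (abs_realSign_le_one _)
  rw [abs_le] at habs
  simp only [response, Set.mem_Icc]
  constructor <;> linarith

theorem response_smul (τ : ℝ) (v y : E) (x : F) :
    response τ v y • x = (τ / 2) • x + (‖v‖ / 2) • Real.sign (inner ℝ y v) • x := by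
  rw [smul_smul, ← add_smul, response]
  congr 1
  ring

variable [FiniteDimensional ℝ E] [MeasurableSpace E] [BorelSpace E]

theorem measurable_response (τ : ℝ) (v : E) : Measurable (response τ v) :=
  (((measurable_realSign.comp (by fun_prop)).const_mul _).const_add _).div_const _

theorem integrableOn_ball_response_smul (τ : ℝ) (v : E) {f : E → F} (hf : Continuous f) :
    IntegrableOn (fun y => response τ v y • f y) (Metric.ball 0 1) := by
  simp only [response_smul]
  exact ((integrableOn_ball_of_continuous hf).smul _).add
    ((integrableOn_ball_sign_smul v hf).smul _)

theorem integral_ball_response_smul (τ : ℝ) (v : E) {f : E → F} (hf : Continuous f) :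
    ∫ y in Metric.ball 0 1, response τ v y • f y
      = (τ / 2) • (∫ y in Metric.ball 0 1, f y)
        + (‖v‖ / 2) • ∫ y in Metric.ball 0 1, Real.sign (inner ℝ y v) • f y := by
  have hf' := integrableOn_ball_of_continuous hf
  have hsign := integrableOn_ball_sign_smul v hf
  simp only [response_smul]
  rw [← integral_smul, ← integral_smul]
  exact integral_add (hf'.smul _) (hsign.smul _)

theorem integral_ball_response_smul_of_even (τ : ℝ) (v : E) {f : E → F} (hf : Continuous f)
    (heven : ∀ y, f (-y) = f y) :
    ∫ y in Metric.ball 0 1, response τ v y • f y = (τ / 2) • ∫ y in Metric.ball 0 1, f y := by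
  rw [integral_ball_response_smul τ v hf,
    integral_ball_eq_zero_of_odd (f := fun y => Real.sign (inner ℝ y v) • f y) fun y => by
      rw [inner_neg_left, Real.sign_neg, heven, neg_smul], smul_zero, add_zero]

theorem integral_ball_response_smul_self (τ : ℝ) (v : E) {e : E} (he : ‖e‖ = 1) :
    ∫ y in Metric.ball 0 1, response τ v y • y
      = (1 / 2 * ∫ y in Metric.ball 0 1, |inner ℝ y e|) • v := by
  rw [integral_ball_response_smul τ v continuous_id',
    integral_ball_eq_zero_of_odd (f := fun y => y) fun _ => rfl, smul_zero, zero_add, mul_smul,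
    ← norm_smul_integral_ball_sign_smul v he, smul_smul]
  congr 1
  ring

end SignResponse

theorem isHermitian_pauli (μ : Fin 4) : (pauli μ).IsHermitian := by
  ext i j
  fin_cases μ <;> fin_cases i <;> fin_cases j <;> simp [pauli]

theorem ofReal_re_trace_mul {n : Type*} [Fintype n] {A B : Matrix n n ℂ} (hA : A.IsHermitian)
    (hB : B.IsHermitian) : ((A * B).trace.re : ℂ) = (A * B).trace := by
  rw [← Complex.conj_eq_iff_re, starRingEnd_apply, ← Matrix.trace_conjTranspose,
    Matrix.conjTranspose_mul, hA, hB, Matrix.trace_mul_comm]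

/-- The vector `v` with `E = (Tr E + v·σ) / 2`, for Hermitian `E`. -/
noncomputable def blochVector (E : Op) : Space :=
  WithLp.toLp 2 fun i => (E * pauli i.succ).trace.re

theorem blochVector_one_sub (E : Op) : blochVector (1 - E) = -blochVector E := by
  ext i
  simp [blochVector, sub_mul, trace_pauli]

theorem norm_blochVector_le {E : Op} (hE : E.PosSemidef) : ‖blochVector E‖ ≤ E.trace.re := by
  have htrace : 0 ≤ E.trace.re := (Complex.nonneg_iff.1 hE.trace_nonneg).1
  have hdet : 0 ≤ E.det.re := (Complex.nonneg_iff.1 hE.det_nonneg).1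
  have hx := (Complex.nonneg_iff.1 (hE.diag_nonneg (i := 0))).2
  have hz := (Complex.nonneg_iff.1 (hE.diag_nonneg (i := 1))).2
  have hy : E 1 0 = star (E 0 1) := (hE.1.apply 1 0).symm
  refine abs_le_of_sq_le_sq' ?_ htrace |>.2
  have hnorm : E.trace.re ^ 2 - ‖blochVector E‖ ^ 2 = 4 * E.det.re := by
    rw [EuclideanSpace.real_norm_sq_eq]
    simp [blochVector, Fin.sum_univ_three, pauli, Matrix.trace_fin_two, Matrix.det_fin_two, hy,
      Matrix.mul_apply, ← hx, ← hz]
    ring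
  linarith

/-- The operator `(1 + x·σ) / 2`, a qubit state for every `x` in the unit ball. -/
noncomputable def blochState (x : Space) : Op :=
  (1 / 2 : ℂ) • (1 + ∑ i, (x i : ℂ) • pauli i.succ)

theorem blochState_apply (x : Space) (i j : Fin 2) :
    blochState x i j = 1 / 2 * ((1 : Op) i j + ∑ l, (x l : ℂ) * pauli l.succ i j) := by
  simp only [blochState, Matrix.smul_apply, Matrix.add_apply, Matrix.sum_apply, smul_eq_mul]

theorem isState_blochState {x : Space} (hx : ‖x‖ ≤ 1) : IsState (blochState x) := by
  have hentries : blochState x = !![(((1 + x 2) / 2 : ℝ) : ℂ), (x 0 - x 1 * Complex.I) / 2;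
      star ((x 0 - x 1 * Complex.I) / 2), ((1 - x 2) / 2 : ℝ)] := by
    ext i j
    fin_cases i <;> fin_cases j <;> simp [blochState, pauli, Fin.sum_univ_three] <;> ring
  have hsq : x 0 ^ 2 + x 1 ^ 2 + x 2 ^ 2 ≤ 1 := by
    rw [← Fin.sum_univ_three (fun i => x i ^ 2), ← EuclideanSpace.real_norm_sq_eq]
    exact pow_le_one₀ (norm_nonneg x) hx
  rw [hentries]
  refine ⟨posSemidef_fin_two (by linarith) ?_, ?_⟩
  · simp [Complex.normSq_apply]
    linarith
  · rw [Matrix.trace_fin_two_of]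
    push_cast
    ring

theorem integral_ball_abs_coord : ∫ y : Space in Metric.ball 0 1, |y 2| = Real.pi / 2 := by
  have hnorm (y : Space) : ‖diagMap ![0, 0, 1] y‖ = |y 2| := by
    simp [norm_diagMap, Fin.sum_univ_three, Real.sqrt_sq_eq_abs]
  simp only [← hnorm, integral_ball_norm_diagMap]
  rw [borderIntegral_of_eq_zero rfl rfl]
  simp

theorem integral_ball_response_mul_coord (τ : ℝ) (v : Space) (l : Fin 3) :
    ∫ y in Metric.ball 0 1, response τ v y * y l = Real.pi / 4 * v l := by
  have he : ‖(EuclideanSpace.single 2 1 : Space)‖ = 1 := by simp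
  have hcoord := (EuclideanSpace.proj l : Space →L[ℝ] ℝ).integral_comp_comm
    (integrableOn_ball_response_smul τ v continuous_id')
  simp only [PiLp.proj_apply, PiLp.smul_apply, smul_eq_mul] at hcoord
  rw [hcoord, integral_ball_response_smul_self τ v he]
  simp only [EuclideanSpace.inner_single_right, one_mul, conj_trivial, integral_ball_abs_coord,
    PiLp.smul_apply, smul_eq_mul]
  ring

/-- The density, on the unit ball of Bloch vectors, of the law of the hidden variable for the
T-state of `diag t`. The second summand makes up for the deficit of `borderIntegral t`. -/
noncomputable def hiddenWeight (t : Fin 3 → ℝ) (y : Space) : ℝ :=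
  2 / Real.pi * (‖diagMap t y‖ + (1 - borderIntegral t) * |y 2|)

/-- The law of the hidden variable for the T-state of `diag t`. -/
noncomputable def hiddenMeasure (t : Fin 3 → ℝ) : Measure Space :=
  (volume.restrict (Metric.ball 0 1)).withDensity fun y => ENNReal.ofReal (hiddenWeight t y)

/-- Bob's hidden state for the T-state of `diag t` at the hidden variable `y`. -/
noncomputable def hiddenState (t : Fin 3 → ℝ) (y : Space) : Op :=
  blochState ((2 / Real.pi / hiddenWeight t y) • diagMap t y)

section HiddenEnsemble

variable {t : Fin 3 → ℝ}

theorem continuous_hiddenWeight : Continuous (hiddenWeight t) := by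
  unfold hiddenWeight
  fun_prop

theorem hiddenWeight_neg (y : Space) : hiddenWeight t (-y) = hiddenWeight t y := by
  simp only [hiddenWeight, map_neg, norm_neg, PiLp.neg_apply, abs_neg]

theorem integral_ball_hiddenWeight : ∫ y in Metric.ball 0 1, hiddenWeight t y = 1 := by
  simp only [hiddenWeight]
  rw [integral_const_mul, integral_add (integrableOn_ball_of_continuous (by fun_prop))
    (integrableOn_ball_of_continuous (by fun_prop)), integral_const_mul,
    integral_ball_norm_diagMap, integral_ball_abs_coord]
  field_simp
  ring

theorem norm_diagMap_le_hiddenWeight (h : borderIntegral t ≤ 1) (y : Space) :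
    2 / Real.pi * ‖diagMap t y‖ ≤ hiddenWeight t y := by
  have : 0 ≤ (1 - borderIntegral t) * |y 2| := mul_nonneg (sub_nonneg.2 h) (abs_nonneg _)
  rw [hiddenWeight]
  gcongr
  linarith

theorem hiddenWeight_nonneg (h : borderIntegral t ≤ 1) (y : Space) : 0 ≤ hiddenWeight t y :=
  (by positivity : 0 ≤ 2 / Real.pi * ‖diagMap t y‖).trans (norm_diagMap_le_hiddenWeight h y)

theorem isEnsemble_hiddenState (h : borderIntegral t ≤ 1) :
    IsEnsemble (hiddenMeasure t) (hiddenState t) where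
  isProbabilityMeasure := by
    refine ⟨?_⟩
    rw [hiddenMeasure, withDensity_apply _ MeasurableSet.univ, Measure.restrict_univ,
      ← ofReal_integral_eq_lintegral_ofReal
        (integrableOn_ball_of_continuous continuous_hiddenWeight)
        (ae_of_all _ (hiddenWeight_nonneg h)), integral_ball_hiddenWeight, ENNReal.ofReal_one]
  measurable i j := by
    have := (continuous_hiddenWeight (t := t)).measurable
    simp only [hiddenState, blochState_apply]
    fun_prop
  isState y := by
    refine isState_blochState ?_
    have hnonneg := hiddenWeight_nonneg h y
    rw [norm_smul, Real.norm_of_nonneg (by positivity), div_mul_eq_mul_div]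
    exact div_le_one_of_le₀ (norm_diagMap_le_hiddenWeight h y) hnonneg

theorem hiddenWeight_mul_hiddenState (h : borderIntegral t ≤ 1) (y : Space) (i j : Fin 2) :
    (hiddenWeight t y : ℂ) * hiddenState t y i j
      = 1 / 2 * (hiddenWeight t y * (1 : Op) i j
        + 2 / Real.pi * ∑ l, (y l : ℂ) * (t l * pauli l.succ i j)) := by
  have hcancel : hiddenWeight t y • ((2 / Real.pi / hiddenWeight t y) • diagMap t y)
      = (2 / Real.pi) • diagMap t y := by
    rcases eq_or_ne (hiddenWeight t y) 0 with h0 | h0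
    · have hle := h0 ▸ norm_diagMap_le_hiddenWeight h y
      have hpos : 0 < 2 / Real.pi := by positivity
      rw [norm_le_zero_iff.1 (nonpos_of_mul_nonpos_right hle hpos)]
      simp
    · rw [smul_smul, mul_div_cancel₀ _ h0]
  have hcoord (l) : (hiddenWeight t y : ℂ)
      * (((2 / Real.pi / hiddenWeight t y) • diagMap t y) l : ℝ) = 2 / Real.pi * (t l * y l) := by
    have := congrArg (fun x : Space => (x l : ℂ)) hcancel
    simpa only [PiLp.smul_apply, smul_eq_mul, diagMap_apply, Complex.ofReal_mul,
      Complex.ofReal_div, Complex.ofReal_ofNat] using this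
  rw [hiddenState, blochState_apply, mul_left_comm, mul_add, Finset.mul_sum, Finset.mul_sum]
  congr 2
  refine Finset.sum_congr rfl fun l _ => ?_
  rw [← mul_assoc, hcoord]
  ring

theorem integral_response_mul_hiddenState (h : borderIntegral t ≤ 1) (τ : ℝ) (v : Space)
    (i j : Fin 2) :
    ∫ y, (response τ v y : ℂ) * hiddenState t y i j ∂hiddenMeasure t
      = 1 / 4 * (τ * (1 : Op) i j + ∑ l, (v l : ℂ) * (t l * pauli l.succ i j)) := by
  have hpointwise (y) : hiddenWeight t y • ((response τ v y : ℂ) * hiddenState t y i j)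
      = ((response τ v y * hiddenWeight t y : ℝ) : ℂ) * (1 / 2 * (1 : Op) i j)
        + ∑ l, ((response τ v y * y l : ℝ) : ℂ) * (1 / Real.pi * (t l * pauli l.succ i j)) := by
    rw [Complex.real_smul, mul_left_comm, hiddenWeight_mul_hiddenState h]
    simp only [Complex.ofReal_mul, Finset.mul_sum, mul_add]
    congr 1
    · ring
    · exact Finset.sum_congr rfl fun l _ => by ring
  have hint {f : Space → ℝ} (hf : Continuous f) (c : ℂ) :
      IntegrableOn (fun y => ((response τ v y * f y : ℝ) : ℂ) * c) (Metric.ball 0 1) :=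
    (integrableOn_ball_response_smul τ v hf).ofReal.mul_const c
  rw [hiddenMeasure, integral_withDensity_eq_integral_toReal_smul
    continuous_hiddenWeight.measurable.ennreal_ofReal (ae_of_all _ fun _ => ENNReal.ofReal_lt_top)]
  simp only [ENNReal.toReal_ofReal (hiddenWeight_nonneg h _), hpointwise]
  have hone := integral_ball_response_smul_of_even τ v continuous_hiddenWeight
    (hiddenWeight_neg (t := t))
  simp only [smul_eq_mul, integral_ball_hiddenWeight, mul_one] at hone
  rw [integral_add (hint continuous_hiddenWeight _)
    (integrable_finsetSum _ fun l _ => hint (by fun_prop) _),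
    integral_finsetSum _ fun l _ => hint (by fun_prop) _]
  simp only [integral_mul_const, integral_complex_ofReal, hone, integral_ball_response_mul_coord,
    mul_add, Finset.mul_sum]
  have hπ : (Real.pi : ℂ) ≠ 0 := Complex.ofReal_ne_zero.2 Real.pi_ne_zero
  push_cast
  congr 1
  · ring
  · exact Finset.sum_congr rfl fun l _ => by field_simp

theorem isResponse_hiddenState (h : borderIntegral t ≤ 1) {E : Op} (hE : E.PosSemidef)
    (hE' : (1 - E).PosSemidef) :
    IsResponse (hiddenMeasure t) (hiddenState t) (canonicalState 0 t) E
      (response E.trace.re (blochVector E)) where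
  measurable := measurable_response _ _
  mem_Icc := response_mem_Icc (norm_blochVector_le hE) (by
    rw [← norm_neg, ← blochVector_one_sub]
    exact (norm_blochVector_le hE').trans_eq (by simp))
  conditionalState_eq i j := by
    have htrace : (E.trace.re : ℂ) = E.trace := by
      simpa using ofReal_re_trace_mul hE.1 Matrix.isHermitian_one
    have hvector (l) : (blochVector E l : ℂ) = (E * pauli l.succ).trace :=
      ofReal_re_trace_mul hE.1 (isHermitian_pauli _)
    rw [integral_response_mul_hiddenState h, htrace, conditionalState_canonicalState]
    simp [hvector, Matrix.sum_apply, mul_left_comm, mul_assoc]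

end HiddenEnsemble

theorem nonSteerable_canonicalState_of_borderIntegral_le_one {t : Fin 3 → ℝ}
    (h : borderIntegral t ≤ 1) : NonSteerable (canonicalState 0 t) := by
  have hresp {E} := isResponse_hiddenState h (E := E)
  refine nonSteerable_iff.2 ⟨Space, _, hiddenMeasure t, hiddenState t, isEnsemble_hiddenState h,
    ?_, fun Q hQ => ⟨_, hresp (posSemidef_of_isStarProjection hQ)
      (posSemidef_of_isStarProjection hQ.one_sub)⟩⟩
  have hone : response (1 : Op).trace.re (blochVector 1) = 1 := by
    have hvector : blochVector 1 = 0 := by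
      rw [← sub_zero 1, blochVector_one_sub, neg_eq_zero]
      ext
      simp [blochVector]
    ext y
    simp [hvector, response]
  exact hone ▸ hresp Matrix.PosSemidef.one (by simpa using Matrix.PosSemidef.zero)

/-! ### The surface -/

theorem bracket_cot_pos {a : ℝ} (ha : a < 1) (α : ℝ) :
    0 < bracket (2 * Real.cot α ^ 2 / (1 - a) - 1) := by
  have : 0 < 1 - a := sub_pos.2 ha
  have : 0 ≤ 2 * Real.cot α ^ 2 / (1 - a) := by positivity
  exact bracket_pos (by linarith)

theorem surfaceRadius_pos {a α : ℝ} (ha : a < 1) (hα : α ∈ Set.Icc 0 Real.pi) :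
    0 < surfaceRadius a α := by
  have ha' : 0 < 1 - a := sub_pos.2 ha
  rw [surfaceRadius]
  split_ifs with hsin
  · exact ha'
  · have hsin' : 0 < Real.sin α := (Real.sin_nonneg_of_mem_Icc hα).lt_of_ne' hsin
    have := bracket_cot_pos ha α
    positivity

theorem borderIntegral_eq_div_surfaceRadius_of_pos {a α r : ℝ} (ha : a < 1)
    (hr : 0 < r * Real.sin α) {t : Fin 3 → ℝ}
    (h0 : 2 * (1 - a) * t 0 ^ 2 = (r * Real.sin α) ^ 2)
    (h1 : 2 * (1 - a) * t 1 ^ 2 = (r * Real.sin α) ^ 2)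
    (h2 : (1 - a) ^ 2 * t 2 ^ 2 = (r * Real.cos α) ^ 2) :
    borderIntegral t = r / surfaceRadius a α := by
  have ha' : 0 < 1 - a := sub_pos.2 ha
  have hr' : r ≠ 0 := left_ne_zero_of_mul hr.ne'
  have hsin : Real.sin α ≠ 0 := right_ne_zero_of_mul hr.ne'
  have hp : (r * Real.sin α / √(2 * (1 - a))) ^ 2 = (r * Real.sin α) ^ 2 / (2 * (1 - a)) := by
    rw [div_pow, Real.sq_sqrt (by positivity)]
  have hequator {x : ℝ} (hx : 2 * (1 - a) * x ^ 2 = (r * Real.sin α) ^ 2) :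
      x ^ 2 = (r * Real.sin α / √(2 * (1 - a))) ^ 2 := by
    rw [hp, ← hx]
    field_simp
  have hc : t 2 ^ 2 / ((r * Real.sin α) ^ 2 / (2 * (1 - a))) - 1
      = 2 * Real.cot α ^ 2 / (1 - a) - 1 := by
    rw [eq_div_of_mul_eq (by positivity) ((mul_comm _ _).trans h2), Real.cot_eq_cos_div_sin]
    field_simp
  have := (bracket_cot_pos ha α).ne'
  rw [borderIntegral_eq_bracket (by positivity) (hequator h0) (hequator h1), hp, hc,
    surfaceRadius, if_neg hsin]
  field_simp

theorem borderIntegral_eq_div_surfaceRadius {a α β r : ℝ} (ha : a < 1)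
    (hα : α ∈ Set.Icc 0 Real.pi) (hβ : Real.cos β = Real.sin β) (hr : 0 ≤ r) {t : Fin 3 → ℝ}
    (h0 : (1 - a) * t 0 ^ 2 = sph r α β 0 ^ 2) (h1 : (1 - a) * t 1 ^ 2 = sph r α β 1 ^ 2)
    (h2 : (1 - a) ^ 2 * t 2 ^ 2 = sph r α β 2 ^ 2) :
    borderIntegral t = r / surfaceRadius a α := by
  have ha' : 0 < 1 - a := sub_pos.2 ha
  simp only [sph, Matrix.cons_val, ← hβ] at h0 h1 h2
  rcases (mul_nonneg hr (Real.sin_nonneg_of_mem_Icc hα)).eq_or_lt' with hzero | hpos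
  · simp only [hzero, zero_mul, zero_pow two_ne_zero, mul_eq_zero, ha'.ne', false_or,
      pow_eq_zero_iff two_ne_zero] at h0 h1
    have ht2 : |t 2| = r * |Real.cos α| / (1 - a) := by
      rw [eq_div_iff ha'.ne', ← abs_of_nonneg hr, ← abs_mul, ← abs_of_pos ha', ← abs_mul,
        ← sq_eq_sq_iff_abs_eq_abs, ← h2]
      ring
    rw [borderIntegral_of_eq_zero h0 h1, ht2]
    rcases mul_eq_zero.1 hzero with rfl | hsin
    · simp
    · have habs : |Real.cos α| = 1 := by
        rcases Real.sin_eq_zero_iff_cos_eq.1 hsin with hc | hc <;> simp [hc]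
      rw [habs, mul_one, surfaceRadius, if_pos hsin]
  · have hcos : 2 * Real.cos β ^ 2 = 1 := by
      have := Real.sin_sq_add_cos_sq β
      rw [← hβ] at this
      linarith
    have hequator {x : ℝ} (hx : (1 - a) * x ^ 2 = (r * Real.sin α * Real.cos β) ^ 2) :
        2 * (1 - a) * x ^ 2 = (r * Real.sin α) ^ 2 := by
      linear_combination 2 * hx + (r * Real.sin α) ^ 2 * hcos
    exact borderIntegral_eq_div_surfaceRadius_of_pos ha hpos (hequator h0) (hequator h1) h2

theorem borderIntegral_of_applyAlice_extremalMatrix_eq {a α β r u : ℝ} (ha : a < 1)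
    (hα : α ∈ Set.Icc 0 Real.pi) (hβ : Real.cos β = Real.sin β) (hr : 0 ≤ r) {t : Fin 3 → ℝ}
    (h : applyAlice (pauliMap (extremalMatrix u u)) (canonicalState 0 t)
      = canonicalState ![0, 0, a] (sph r α β)) :
    borderIntegral t = r / surfaceRadius a α := by
  rw [applyAlice_extremalMatrix, canonicalState_inj] at h
  obtain ⟨hsin, ht⟩ := h
  have hcos : 1 - a = Real.cos u ^ 2 := by
    rw [Real.cos_sq', sq, show Real.sin u * Real.sin u = a from congrFun hsin 2]
  refine borderIntegral_eq_div_surfaceRadius ha hα hβ hr ?_ ?_ ?_ <;>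
  · rw [← ht, hcos]
    simp only [Matrix.cons_val]
    ring

theorem exists_applyAlice_extremalMatrix_eq {a : ℝ} (ha0 : 0 ≤ a) (ha1 : a < 1)
    (t' : Fin 3 → ℝ) :
    ∃ u ∈ Set.Ico 0 Real.pi, ∃ t, applyAlice (pauliMap (extremalMatrix u u)) (canonicalState 0 t)
      = canonicalState ![0, 0, a] t' := by
  have hsin : Real.sin (Real.arcsin √a) = √a :=
    Real.sin_arcsin (by linarith [Real.sqrt_nonneg a]) (Real.sqrt_le_one.2 ha1.le)
  have hcos : Real.cos (Real.arcsin √a) = √(1 - a) := by rw [Real.cos_arcsin, Real.sq_sqrt ha0]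
  have hne : √(1 - a) ≠ 0 := (Real.sqrt_pos.2 (sub_pos.2 ha1)).ne'
  refine ⟨Real.arcsin √a, ⟨Real.arcsin_nonneg.2 (Real.sqrt_nonneg a),
    (Real.arcsin_le_pi_div_two _).trans_lt (by linarith [Real.pi_pos])⟩,
    ![t' 0 / √(1 - a), t' 1 / √(1 - a), t' 2 / (√(1 - a) * √(1 - a))], ?_⟩
  rw [applyAlice_extremalMatrix, hsin, hcos, Real.mul_self_sqrt ha0]
  congr 1
  ext i
  fin_cases i <;> simp [mul_div_cancel₀, hne]

theorem eq_surfaceRadius_iff {a α β r : ℝ} (ha0 : 0 ≤ a) (ha1 : a < 1)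
    (hα : α ∈ Set.Icc 0 Real.pi) (hβ : Real.cos β = Real.sin β) (hr : 0 ≤ r) :
    r = surfaceRadius a α ↔
      ∃ u ∈ Set.Ico 0 Real.pi, ∃ t : Fin 3 → ℝ, IsBorderT t ∧
        applyAlice (pauliMap (extremalMatrix u u)) (canonicalState 0 t)
          = canonicalState ![0, 0, a] (sph r α β) := by
  have hborder {u t} (h : applyAlice (pauliMap (extremalMatrix u u)) (canonicalState 0 t)
      = canonicalState ![0, 0, a] (sph r α β)) : IsBorderT t ↔ r = surfaceRadius a α := by
    change borderIntegral t = 1 ↔ _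
    rw [borderIntegral_of_applyAlice_extremalMatrix_eq ha1 hα hβ hr h,
      div_eq_one_iff_eq (surfaceRadius_pos ha1 hα).ne']
  constructor
  · intro hR
    obtain ⟨u, hu, t, h⟩ := exists_applyAlice_extremalMatrix_eq ha0 ha1 (sph r α β)
    exact ⟨u, hu, t, (hborder h).2 hR, h⟩
  · rintro ⟨u, -, t, ht, h⟩
    exact (hborder h).1 ht

theorem nonSteerable_canonicalState_of_le_surfaceRadius {a α β r : ℝ} (ha0 : 0 ≤ a) (ha1 : a < 1)
    (hα : α ∈ Set.Icc 0 Real.pi) (hβ : Real.cos β = Real.sin β) (hr : 0 ≤ r)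
    (hR : r ≤ surfaceRadius a α) : NonSteerable (canonicalState ![0, 0, a] (sph r α β)) := by
  obtain ⟨u, -, t, h⟩ := exists_applyAlice_extremalMatrix_eq ha0 ha1 (sph r α β)
  have hborder : borderIntegral t ≤ 1 := by
    rw [borderIntegral_of_applyAlice_extremalMatrix_eq ha1 hα hβ hr h]
    exact div_le_one_of_le₀ hR (hr.trans hR)
  rw [← h, pauliMap_extremalMatrix]
  exact (nonSteerable_canonicalState_of_borderIntegral_le_one hborder).applyAlice_krausMap
    (sum_conjTranspose_mul_extremalKraus u u)

theorem bracket_neg_half : bracket (-(1 / 2)) = √2 / 2 * (1 + Real.pi / 2) := by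
  have harcsin : Real.arcsin (√2 / 2) = Real.pi / 4 :=
    Real.arcsin_eq_of_sin_eq Real.sin_pi_div_four
      ⟨by linarith [Real.pi_pos], by linarith [Real.pi_pos]⟩
  have hhalf : √(1 / 2) = √2 / 2 := by
    rw [Real.sqrt_div_self', Real.sqrt_div zero_le_one, Real.sqrt_one]
  have hsqrt : √2 ^ 2 = 2 := Real.sq_sqrt zero_le_two
  rw [bracket, if_pos (by norm_num), neg_neg, show (1 + -(1 / 2) : ℝ) = 1 / 2 by norm_num, hhalf,
    harcsin]
  field_simp
  linear_combination (-4 * Real.pi) * hsqrt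

theorem sin_arccos_neg_three_sevenths : Real.sin (Real.arccos (-(3 / 7))) = 2 * √5 * √2 / 7 := by
  rw [Real.sin_arccos, Real.sqrt_eq_iff_eq_sq (by norm_num) (by positivity)]
  simp only [mul_pow, div_pow, Real.sq_sqrt, Nat.ofNat_nonneg]
  norm_num

theorem sph_arccos_neg_three_sevenths :
    sph (4 / 5) (Real.arccos (-(3 / 7))) (5 * Real.pi / 4)
      = ![-(8 * √5 / 35), -(8 * √5 / 35), -(12 / 35)] := by
  have hangle : 5 * Real.pi / 4 = Real.pi / 4 + Real.pi := by ring
  have hxy : 4 / 5 * (2 * √5 * √2 / 7) * (√2 / 2) = 8 * √5 / 35 := by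
    linear_combination 4 / 35 * √5 * Real.mul_self_sqrt zero_le_two
  rw [sph, hangle, Real.cos_add_pi, Real.sin_add_pi, Real.cos_pi_div_four, Real.sin_pi_div_four,
    Real.cos_arccos (by norm_num) (by norm_num), sin_arccos_neg_three_sevenths]
  simp only [mul_neg, hxy]
  norm_num

theorem four_fifths_le_surfaceRadius :
    4 / 5 ≤ surfaceRadius (1 / 10) (Real.arccos (-(3 / 7))) := by
  have hcot : Real.cot (Real.arccos (-(3 / 7))) ^ 2 = 9 / 40 := by
    rw [Real.cot_eq_cos_div_sin, Real.cos_arccos (by norm_num) (by norm_num),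
      sin_arccos_neg_three_sevenths]
    simp only [mul_pow, div_pow, Real.sq_sqrt, Nat.ofNat_nonneg]
    norm_num
  have hsqrt : √(2 * (1 - 1 / 10)) = 3 * √5 / 5 := by
    rw [Real.sqrt_eq_iff_eq_sq (by norm_num) (by positivity)]
    simp only [mul_pow, div_pow, Real.sq_sqrt, Nat.ofNat_nonneg]
    norm_num
  have hsq : √2 ^ 2 = 2 := Real.sq_sqrt zero_le_two
  have hR : surfaceRadius (1 / 10) (Real.arccos (-(3 / 7))) = 21 / (5 * (2 + Real.pi)) := by
    rw [surfaceRadius, if_neg (by rw [sin_arccos_neg_three_sevenths]; positivity), hcot,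
      show 2 * (9 / 40) / (1 - 1 / 10) - 1 = (-(1 / 2) : ℝ) by norm_num, bracket_neg_half, hsqrt,
      sin_arccos_neg_three_sevenths]
    have : Real.pi ≠ -2 := by linarith [Real.pi_pos]
    field_simp
    rw [hsq]
    field_simp
    norm_num
  rw [hR, le_div_iff₀ (by positivity)]
  linarith [Real.pi_lt_d2]

theorem BowlesCriterion.sq_add_two_mul_abs_le {a t : Fin 3 → ℝ} (h : BowlesCriterion a t)
    (i : Fin 3) : a i ^ 2 + 2 * |t i| ≤ 1 := by
  simpa [Pi.single_apply, Real.sqrt_sq_eq_abs, ite_pow] using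
    h (Pi.single i 1) (by simp [Pi.single_apply])

theorem exists_entangled_not_bowlesCriterion :
    ∃ α ∈ Set.Icc (Real.pi / 2) Real.pi, ∃ r : ℝ, 0 ≤ r ∧ r ≤ surfaceRadius (1 / 10) α ∧
      IsState (canonicalState ![0, 0, 1 / 10] (sph r α (5 * Real.pi / 4))) ∧
      ¬ IsSeparable (canonicalState ![0, 0, 1 / 10] (sph r α (5 * Real.pi / 4))) ∧
      ¬ BowlesCriterion ![0, 0, 1 / 10] (sph r α (5 * Real.pi / 4)) := by
  have hlower : 11 / 5 < √5 := Real.lt_sqrt_of_sq_lt (by norm_num)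
  have hsq : √5 ^ 2 = 5 := Real.sq_sqrt (by norm_num)
  refine ⟨Real.arccos (-(3 / 7)), ⟨?_, Real.arccos_le_pi _⟩, 4 / 5, by norm_num,
    four_fifths_le_surfaceRadius, ?_⟩
  · rw [Real.arccos_neg]
    linarith [Real.arccos_le_pi_div_two.2 (by norm_num : (0 : ℝ) ≤ 3 / 7)]
  rw [sph_arccos_neg_three_sevenths]
  refine ⟨isState_canonicalState ?_ ?_ ?_, fun hsep => ?_, fun hbowles => ?_⟩
  · rw [abs_of_pos] <;> norm_num
  · norm_num
  · linarith
  · have hsum := sum_nonneg_of_isSeparable_canonicalState hsep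
    simp only [Fin.sum_univ_three, Matrix.cons_val] at hsum
    linarith
  · have hle := hbowles.sq_add_two_mul_abs_le 0
    simp only [Matrix.cons_val_zero, abs_neg] at hle
    rw [abs_of_pos (by positivity)] at hle
    linarith

end Steering

theorem mainTheorem3 :
    (∀ a α β r : ℝ, 0 ≤ a → a < 1 → α ∈ Set.Icc 0 Real.pi →
      β ∈ Set.Icc 0 (2 * Real.pi) → Real.cos β = Real.sin β → 0 ≤ r →
      -- the surface consists of the images of border T-states under extremal maps with `u = v`
      (r = Steering.surfaceRadius a α ↔
        ∃ u ∈ Set.Ico 0 Real.pi, ∃ t : Fin 3 → ℝ, Steering.IsBorderT t ∧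
          Steering.applyAlice (Steering.pauliMap (Steering.extremalMatrix u u))
              (Steering.canonicalState 0 t)
            = Steering.canonicalState ![0, 0, a] (Steering.sph r α β)) ∧
      -- states on or inside the surface are non-steerable
      (r ≤ Steering.surfaceRadius a α →
        Steering.IsState (Steering.canonicalState ![0, 0, a] (Steering.sph r α β)) →
        Steering.NonSteerable (Steering.canonicalState ![0, 0, a] (Steering.sph r α β)))) ∧
    -- for `a = 1/10` they include entangled states that violate the criterion of Bowles et al.
    (∃ α ∈ Set.Icc (Real.pi / 2) Real.pi, ∃ r : ℝ, 0 ≤ r ∧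
      r ≤ Steering.surfaceRadius (1 / 10) α ∧
      Steering.IsState
        (Steering.canonicalState ![0, 0, 1 / 10] (Steering.sph r α (5 * Real.pi / 4))) ∧
      ¬ Steering.IsSeparable
        (Steering.canonicalState ![0, 0, 1 / 10] (Steering.sph r α (5 * Real.pi / 4))) ∧
      ¬ Steering.BowlesCriterion ![0, 0, 1 / 10] (Steering.sph r α (5 * Real.pi / 4))) := by
  refine ⟨fun a α β r ha0 ha1 hα _ hβ hr => ⟨?_, fun hR _ => ?_⟩, ?_⟩
  · exact Steering.eq_surfaceRadius_iff ha0 ha1 hα hβ hr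
  · exact Steering.nonSteerable_canonicalState_of_le_surfaceRadius ha0 ha1 hα hβ hr hR
  · exact Steering.exists_entangled_not_bowlesCriterion
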